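/- **Setting.** On $\mathbb R^6\cong\mathbb C^3$ put $(z^1,z^2,z^3)=(x^1+ix^4,x^2+ix^5,x^3+ix^6)$. A *nearly-Kähler structure* on an open set $U\subset\mathbb R^6$ is a smooth pair $\Omega\in\Omega^2(U)$, $\Upsilon\in\Omega^3(U;\mathbb C)$ such that at each $y\in U$ there is a linear isomorphism $f:T_yU\to\mathbb R^6$ (an *$\mathrm{SU}(3)$-coframe*) with $\Omega_y=f^*(dx^1\wedge dx^4+dx^2\wedge dx^5+dx^3\wedge dx^6)$ and $\Upsilon_y=f^*(dz^1\wedge dz^2\wedge dz^3)$, and such that $d\Omega=3\,\mathrm{Im}\,\Upsilon$, $d\,\mathrm{Re}\,\Upsilon=2\,\Omega\wedge\Omega$, $d\,\mathrm{Im}\,\Upsilon=0$. Let a connected Lie group $G$ act smoothly and faithfully on $U$, preserving $(\Omega,\Upsilon)$, closed in the isometry group, with all orbits principal, $4$-dimensional and coisotropic (that is, $\Omega\wedge\Omega$ vanishes on them). Let $P\to U$ be the $\mathrm O(2)$-bundle whose fibre over $y$ consists of the $\mathrm{SU}(3)$-coframes $f=(f^1,\dots,f^6)$ at $y$ with $T_y(Gy)=\ker(f^1,f^2)$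 (*$\mathrm O(2)$-coframes*), let $\omega^1,\dots,\omega^6$ be the tautological $1$-forms on $P$, and put $\eta=\omega^1+i\omega^2$, $\theta=\omega^4+i\omega^5$. There are unique functions $p_1,\dots,p_4,q_1,q_2,r:P\to\mathbb C$ and $h_1,\dots,h_4:P\to\mathbb R$ and a unique real $1$-form $\alpha$ on $P$ such that, with $$\begin{aligned}2\xi_1&=h_1\eta-ih_2\theta+q_1\bar\theta+p_1\omega^3+p_2\omega^6,&2\xi_2&=ih_4\eta+(h_3-i)\theta+q_2\bar\theta-ip_2\omega^3+p_3\omega^6,\\ \xi_3&=p_4\theta-ir\bar\theta-iq_1\omega^3+q_2\omega^6,&\xi_0&=\bar p_4\theta+p_4\bar\theta-h_2\omega^3+h_3\omega^6,\end{aligned}$$ one has $$\begin{aligned} d\eta&=i\alpha\wedge\eta-2i\xi_1\wedge\omega^3+\xi_0\wedge\theta+\xi_3\wedge\bar\theta+2\xi_2\wedge\omega^6+i(-\eta\wedge\omega^3+\theta\wedge\omega^6),\\ d\omega^3&=-i\bar\xi_1\wedge\eta+i\xi_1\wedge\bar\eta+\bar\xi_2\wedge\theta+\xi_2\wedge\bar\theta-2\xi_0\wedge\omega^6+\tfrac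 i2(\eta\wedge\bar\eta-\theta\wedge\bar\theta),\\ d\theta&=-\xi_0\wedge\eta-\xi_3\wedge\bar\eta-2\xi_2\wedge\omega^3+i\alpha\wedge\theta-2i\xi_1\wedge\omega^6+i(-\omega^3\wedge\theta+\eta\wedge\omega^6),\\ d\omega^6&=-\bar\xi_2\wedge\eta-\xi_2\wedge\bar\eta+2\xi_0\wedge\omega^3-i\bar\xi_1\wedge\theta+i\xi_1\wedge\bar\theta+\tfrac i2(\bar\theta\wedge\eta-\theta\wedge\bar\eta). \end{aligned}$$ Put $s_1=(h_1+3)+ih_3$ and $s_2=h_2+ih_4$. The structure is of *Type III* if, everywhere on $P$, $\mathrm{Re}(q_1\bar q_2)=\mathrm{Re}(s_2\bar s_1)=0$ and $(q_1,q_2,s_1,s_2)\neq(0,0,0,0)$. When it is of Type III and the Lie algebra $\mathfrak g$ of $G$ is isomorphic to $\mathfrak{su}(2)\oplus\mathfrak u(1)$, there are unique functions $u,v,\hat v,z,w:P\to\mathbb C$ and $t_1:P\to\mathbb R$ with $$q_1=it_1z,\quad q_2=z,\quad s_2=it_1w,\quad s_1=w,\quad p_1+4ip_4=6u,\quad p_2=-6t_1u,\quad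 p_3+4p_4=24v,\quad -p_3+4p_4=24\hat v .$$ Put $(a_1,a_2,a_0)=(24\,\mathrm{Re}\,v,\,24\,\mathrm{Im}\,v,\,3t_1):P\to\mathbb R^3$. **Theorem 6.1.** Nearly-Kähler structures of Type III with $\mathfrak g=\mathfrak{su}(2)\oplus\mathfrak u(1)$ and $u=0$ exist locally. In fact, for every $x\in\mathbb R^6$ and every $(x_0,y_0,z_0)\in\mathbb R^3$ there are a connected open neighbourhood $U\subset\mathbb R^6$ of $x$, a nearly-Kähler structure $(\Omega,\Upsilon)$ on $U$ and a connected Lie group $G$ with $\mathfrak g\cong\mathfrak{su}(2)\oplus\mathfrak u(1)$ acting on $U$ as above, such that the structure is of Type III with $u=0$ on all of $P$, and there is an $\mathrm O(2)$-coframe $f_x\in P|_x$ with $$(a_1,a_2,a_0)(f_x)=(x_0,y_0,z_0).$$ -/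

import Mathlib

open Set Filter Topology Complex
open scoped Manifold ContDiff Matrix

noncomputable section

namespace NK

/-- The space `ℝ⁶`. The coordinates `x¹, …, x⁶` are indexed by `0, …, 5`. -/
abbrev R6 : Type := EuclideanSpace ℝ (Fin 6)

/-! ### `SU(3)`-structures and nearly-Kähler structures on open subsets of `ℝ⁶` -/

/-- A differential 2-form on (an open subset of) `ℝ⁶`. -/
abbrev TwoForm : Type := R6 → R6 [⋀^Fin 2]→L[ℝ] ℝ

/-- A complex-valued differential 3-form on (an open subset of) `ℝ⁶`. -/
abbrev ThreeFormC : Type := R6 → R6 [⋀^Fin 3]→L[ℝ] ℂ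

/-- The standard 2-form `dx¹ ∧ dx⁴ + dx² ∧ dx⁵ + dx³ ∧ dx⁶`, evaluated on `v, w`. -/
def stdOmega (v w : R6) : ℝ :=
  (v 0 * w 3 - v 3 * w 0) + (v 1 * w 4 - v 4 * w 1) + (v 2 * w 5 - v 5 * w 2)

/-- The standard complex coordinates `(z¹, z², z³) = (x¹ + i x⁴, x² + i x⁵, x³ + i x⁶)`. -/
def zCoord (v : R6) : Fin 3 → ℂ :=
  ![(v 0 : ℂ) + I * (v 3 : ℂ), (v 1 : ℂ) + I * (v 4 : ℂ), (v 2 : ℂ) + I * (v 5 : ℂ)]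

/-- The standard complex volume form `dz¹ ∧ dz² ∧ dz³`, evaluated on three vectors. -/
def stdUpsilon (v : Fin 3 → R6) : ℂ :=
  Matrix.det (Matrix.of fun i j => zCoord (v j) i)

/-- `f` is a coframe at `y` (an isomorphism `T_y ℝ⁶ → ℝ⁶`) that takes `(Ω, Υ)` at `y` to the standard
model. -/
def IsSU3Coframe (Ω : TwoForm) (Υ : ThreeFormC) (y : R6) (f : R6 →L[ℝ] R6) : Prop :=
  Function.Bijective f ∧
  (∀ v : Fin 2 → R6, Ω y v = stdOmega (f (v 0)) (f (v 1))) ∧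
  (∀ v : Fin 3 → R6, Υ y v = stdUpsilon (fun i => f (v i)))

/-- The real part of a complex 3-form. -/
def rePart (Υ : ThreeFormC) : R6 → R6 [⋀^Fin 3]→L[ℝ] ℝ :=
  fun y => Complex.reCLM.compContinuousAlternatingMap (Υ y)

/-- The imaginary part of a complex 3-form. -/
def imPart (Υ : ThreeFormC) : R6 → R6 [⋀^Fin 3]→L[ℝ] ℝ :=
  fun y => Complex.imCLM.compContinuousAlternatingMap (Υ y)

/-- The 4-form `Ω ∧ Ω` at `y`, evaluated on four vectors. -/
def omegaSq (Ω : TwoForm) (y : R6) (v : Fin 4 → R6) : ℝ :=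
  2 * (Ω y ![v 0, v 1] * Ω y ![v 2, v 3] - Ω y ![v 0, v 2] * Ω y ![v 1, v 3]
    + Ω y ![v 0, v 3] * Ω y ![v 1, v 2])

/-- `(Ω, Υ)` is a (strict, scaled to `c = 1`) nearly-Kähler structure on the open set `U`: a smooth
`SU(3)`-structure with `dΩ = 3 Im Υ`, `d Re Υ = 2 Ω ∧ Ω` and `d Im Υ = 0`. -/
structure IsNearlyKahlerOn (U : Set R6) (Ω : TwoForm) (Υ : ThreeFormC) : Prop where
  smooth_omega : ContDiffOn ℝ ∞ Ω U
  smooth_upsilon : ContDiffOn ℝ ∞ Υ U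
  su3 : ∀ y ∈ U, ∃ f : R6 →L[ℝ] R6, IsSU3Coframe Ω Υ y f
  d_omega : ∀ y ∈ U, extDeriv Ω y = (3 : ℝ) • imPart Υ y
  d_re : ∀ y ∈ U, ∀ v : Fin 4 → R6, extDeriv (rePart Υ) y v = 2 * omegaSq Ω y v
  d_im : ∀ y ∈ U, extDeriv (imPart Υ) y = 0

/-! ### The acting Lie group -/

section Action

variable {V : Type} [NormedAddCommGroup V] [NormedSpace ℝ V]
  {G : Type} [Group G] [TopologicalSpace G] [ChartedSpace V G]

/-- `act` is a smooth (left) action of the Lie group `G` on the open set `U`. -/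
structure IsSmoothActionOn (act : G → R6 → R6) (U : Set R6) : Prop where
  mapsTo : ∀ g, MapsTo (act g) U U
  one : ∀ y ∈ U, act 1 y = y
  mul : ∀ g h, ∀ y ∈ U, act (g * h) y = act g (act h y)
  smooth : ContMDiffOn (𝓘(ℝ, V).prod 𝓘(ℝ, R6)) 𝓘(ℝ, R6) ∞
    (fun p : G × R6 => act p.1 p.2) (univ ×ˢ U)

/-- The tangent space at `y` of the orbit `G y`: the image of the differential at `1` of the orbit
map `g ↦ g y`. -/
def orbitTangent (act : G → R6 → R6) (y : R6) : Submodule ℝ R6 :=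
  LinearMap.range
    (mfderiv 𝓘(ℝ, V) 𝓘(ℝ, R6) (fun g : G => act g y) 1 : V →L[ℝ] R6).toLinearMap

/-- The Lie group `G` acts on `U` through `act`, with cohomogeneity two and coisotropic orbits,
preserving `(Ω, Υ)`. The action is faithful, `G` is closed in the isometry group, and every orbit in
`U` is principal. -/
structure IsCohomTwoSymmetry (U : Set R6) (Ω : TwoForm) (Υ : ThreeFormC)
    (act : G → R6 → R6) : Prop where
  action : IsSmoothActionOn (V := V) act U
  preserves_omega : ∀ g, ∀ y ∈ U, ∀ v : Fin 2 → R6,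
    Ω (act g y) (fun i => fderiv ℝ (act g) y (v i)) = Ω y v
  preserves_upsilon : ∀ g, ∀ y ∈ U, ∀ v : Fin 3 → R6,
    Υ (act g y) (fun i => fderiv ℝ (act g) y (v i)) = Υ y v
  faithful : ∀ g, (∀ y ∈ U, act g y = y) → g = 1
  /-- The image of `G` is closed among the continuous maps `U → U`, for uniform convergence on
  compact sets; in particular it is closed in the isometry group of `U`. -/
  closed : ∀ (g : ℕ → G) (h : R6 → R6), MapsTo h U U →
    TendstoLocallyUniformlyOn (fun n => act (g n)) h atTop U → ∃ k : G, EqOn (act k) h U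
  /-- All orbits have the same type: the stabilizers are conjugate. -/
  principal : ∀ y ∈ U, ∀ z ∈ U, ∃ k : G, ∀ g : G, act g y = y ↔ act (k * g * k⁻¹) z = z
  cohomogeneity_two : ∀ y ∈ U, Module.finrank ℝ (orbitTangent (V := V) act y) = 4
  coisotropic : ∀ y ∈ U, ∀ v : Fin 4 → R6, (∀ i, v i ∈ orbitTangent (V := V) act y) →
    omegaSq Ω y v = 0

end Action

section LieAlgebras

attribute [local instance] LieRing.ofAssociativeRing

/-- The real Lie algebra `𝔲(n)` of skew-Hermitian matrices, with the commutator bracket. -/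
def u (n : ℕ) : LieSubalgebra ℝ (Matrix (Fin n) (Fin n) ℂ) where
  carrier := {A | Aᴴ = -A}
  zero_mem' := by simp
  add_mem' := by
    intro A B hA hB
    change Aᴴ = -A at hA
    change Bᴴ = -B at hB
    change (A + B)ᴴ = -(A + B)
    rw [Matrix.conjTranspose_add, hA, hB, neg_add]
  smul_mem' := by
    intro c A hA
    change Aᴴ = -A at hA
    change (c • A)ᴴ = -(c • A)
    rw [Matrix.conjTranspose_smul, hA, star_trivial, smul_neg]
  lie_mem' := by
    intro A B hA hB
    change Aᴴ = -A at hA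
    change Bᴴ = -B at hB
    change ⁅A, B⁆ᴴ = -⁅A, B⁆
    rw [LieRing.of_associative_ring_bracket, Matrix.conjTranspose_sub,
      Matrix.conjTranspose_mul, Matrix.conjTranspose_mul, hA, hB]
    simp

/-- The real Lie algebra `𝔰𝔲(n)` of traceless skew-Hermitian matrices, with the commutator
bracket. -/
def su (n : ℕ) : LieSubalgebra ℝ (Matrix (Fin n) (Fin n) ℂ) where
  carrier := {A | Aᴴ = -A ∧ A.trace = 0}
  zero_mem' := by simp
  add_mem' := by
    intro A B hA hB
    exact ⟨(u n).add_mem hA.1 hB.1, by rw [Matrix.trace_add, hA.2, hB.2, add_zero]⟩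
  smul_mem' := by
    intro c A hA
    exact ⟨(u n).smul_mem c hA.1, by rw [Matrix.trace_smul, hA.2, smul_zero]⟩
  lie_mem' := by
    intro A B hA hB
    refine ⟨(u n).lie_mem hA.1 hB.1, ?_⟩
    rw [LieRing.of_associative_ring_bracket, Matrix.trace_sub, Matrix.trace_mul_comm, sub_self]

/-- The Lie algebra of the Lie group `G` is isomorphic to `𝔰𝔲(2) ⊕ 𝔲(1)`. -/
def HasLieAlgebraSU2U1 (V : Type) [NormedAddCommGroup V] [NormedSpace ℝ V]
    (G : Type) [Group G] [TopologicalSpace G] [ChartedSpace V G] : Prop :=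
  ∃ e : GroupLieAlgebra 𝓘(ℝ, V) G ≃ₗ[ℝ] (su 2 × u 1), ∀ X Y, e ⁅X, Y⁆ = ⁅e X, e Y⁆

end LieAlgebras

/-! ### The `O(2)`-bundle `P` and its torsion -/

/-- `f` belongs to the fibre over `y` of the `O(2)`-bundle `P` of adapted coframes: `f` is an
`SU(3)`-coframe, and the kernel of its first two components is the plane `W y` (below, the tangent
space of the orbit through `y`). -/
def IsO2Coframe (Ω : TwoForm) (Υ : ThreeFormC) (W : R6 → Submodule ℝ R6) (y : R6)
    (f : R6 →L[ℝ] R6) : Prop :=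
  IsSU3Coframe Ω Υ y f ∧ ∀ v, v ∈ W y ↔ f v 0 = 0 ∧ f v 1 = 0

/-- The values of the torsion functions at an `O(2)`-coframe. -/
structure Torsion where
  (p₁ p₂ p₃ p₄ q₁ q₂ r : ℂ)
  (h₁ h₂ h₃ h₄ : ℝ)

/-- The wedge product of two complex covectors, evaluated on `v, w`. -/
def wedge (a b : R6 → ℂ) (v w : R6) : ℂ := a v * b w - a w * b v

/-- The complex conjugate of a complex covector. -/
def cbar (a : R6 → ℂ) (v : R6) : ℂ := (starRingEnd ℂ) (a v)

/-- `η = ω¹ + i ω²`. -/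
def eta (f : R6 →L[ℝ] R6) (v : R6) : ℂ := (f v 0 : ℂ) + I * (f v 1 : ℂ)

/-- `θ = ω⁴ + i ω⁵`. -/
def theta (f : R6 →L[ℝ] R6) (v : R6) : ℂ := (f v 3 : ℂ) + I * (f v 4 : ℂ)

/-- `ω³`. -/
def omega3 (f : R6 →L[ℝ] R6) (v : R6) : ℂ := (f v 2 : ℂ)

/-- `ω⁶`. -/
def omega6 (f : R6 →L[ℝ] R6) (v : R6) : ℂ := (f v 5 : ℂ)

namespace Torsion

variable (T : Torsion)

/-- `2 ξ₁ = h₁ η - i h₂ θ + q₁ θ̄ + p₁ ω³ + p₂ ω⁶`. -/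
def xi₁ (f : R6 →L[ℝ] R6) (v : R6) : ℂ :=
  (1 / 2 : ℂ) * ((T.h₁ : ℂ) * eta f v - I * (T.h₂ : ℂ) * theta f v + T.q₁ * cbar (theta f) v
    + T.p₁ * omega3 f v + T.p₂ * omega6 f v)

/-- `2 ξ₂ = i h₄ η + (h₃ - i) θ + q₂ θ̄ - i p₂ ω³ + p₃ ω⁶`. -/
def xi₂ (f : R6 →L[ℝ] R6) (v : R6) : ℂ :=
  (1 / 2 : ℂ) * (I * (T.h₄ : ℂ) * eta f v + ((T.h₃ : ℂ) - I) * theta f v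
    + T.q₂ * cbar (theta f) v - I * T.p₂ * omega3 f v + T.p₃ * omega6 f v)

/-- `ξ₃ = p₄ θ - i r θ̄ - i q₁ ω³ + q₂ ω⁶`. -/
def xi₃ (f : R6 →L[ℝ] R6) (v : R6) : ℂ :=
  T.p₄ * theta f v - I * T.r * cbar (theta f) v - I * T.q₁ * omega3 f v + T.q₂ * omega6 f v

/-- `ξ₀ = p̄₄ θ + p₄ θ̄ - h₂ ω³ + h₃ ω⁶`. -/
def xi₀ (f : R6 →L[ℝ] R6) (v : R6) : ℂ :=
  (starRingEnd ℂ) T.p₄ * theta f v + T.p₄ * cbar (theta f) v - (T.h₂ : ℂ) * omega3 f v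
    + (T.h₃ : ℂ) * omega6 f v

/-- The first structure equations for an `O(2)`-coframe `f` with torsion `T` and connection form
`α`, where `df` is the exterior derivative of the coframing at the point considered. -/
structure StructureEquations (f : R6 →L[ℝ] R6) (df : R6 → R6 → R6) (α : R6 →ₗ[ℝ] ℝ) :
    Prop where
  d_eta : ∀ v w, ((df v w 0 : ℝ) : ℂ) + I * ((df v w 1 : ℝ) : ℂ) =
    I * wedge (fun x => (α x : ℂ)) (eta f) v w
    - 2 * I * wedge (T.xi₁ f) (omega3 f) v w
    + wedge (T.xi₀ f) (theta f) v w
    + wedge (T.xi₃ f) (cbar (theta f)) v w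
    + 2 * wedge (T.xi₂ f) (omega6 f) v w
    + I * (- wedge (eta f) (omega3 f) v w + wedge (theta f) (omega6 f) v w)
  d_omega3 : ∀ v w, ((df v w 2 : ℝ) : ℂ) =
    - I * wedge (cbar (T.xi₁ f)) (eta f) v w
    + I * wedge (T.xi₁ f) (cbar (eta f)) v w
    + wedge (cbar (T.xi₂ f)) (theta f) v w
    + wedge (T.xi₂ f) (cbar (theta f)) v w
    - 2 * wedge (T.xi₀ f) (omega6 f) v w
    + I * (1 / 2) * (wedge (eta f) (cbar (eta f)) v w - wedge (theta f) (cbar (theta f)) v w)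
  d_theta : ∀ v w, ((df v w 3 : ℝ) : ℂ) + I * ((df v w 4 : ℝ) : ℂ) =
    - wedge (T.xi₀ f) (eta f) v w
    - wedge (T.xi₃ f) (cbar (eta f)) v w
    - 2 * wedge (T.xi₂ f) (omega3 f) v w
    + I * wedge (fun x => (α x : ℂ)) (theta f) v w
    - 2 * I * wedge (T.xi₁ f) (omega6 f) v w
    + I * (- wedge (omega3 f) (theta f) v w + wedge (eta f) (omega6 f) v w)
  d_omega6 : ∀ v w, ((df v w 5 : ℝ) : ℂ) =
    - wedge (cbar (T.xi₂ f)) (eta f) v w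
    - wedge (T.xi₂ f) (cbar (eta f)) v w
    + 2 * wedge (T.xi₀ f) (omega3 f) v w
    - I * wedge (cbar (T.xi₁ f)) (theta f) v w
    + I * wedge (T.xi₁ f) (cbar (theta f)) v w
    + I * (1 / 2) * (wedge (cbar (theta f)) (eta f) v w - wedge (theta f) (cbar (eta f)) v w)

/-- `T` is the value of the torsion functions of the `O(2)`-structure `P` at the coframe `f ∈ P_y`:
for a local smooth section `σ` of `P` through `f`, the pull-back by `σ` of the structure equations
on `P` holds at `y`, `α` being the pull-back of the connection form. The equations determine `T`
and do not depend on the choice of `σ`. -/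
def IsAt (Ω : TwoForm) (Υ : ThreeFormC) (W : R6 → Submodule ℝ R6) (y : R6)
    (f : R6 →L[ℝ] R6) : Prop :=
  ∃ σ : R6 → R6 →L[ℝ] R6,
    ContDiffAt ℝ ∞ σ y ∧ (∀ᶠ z in 𝓝 y, IsO2Coframe Ω Υ W z (σ z)) ∧ σ y = f ∧
    ∃ α : R6 →ₗ[ℝ] ℝ,
      T.StructureEquations f (fun v w => fderiv ℝ σ y v w - fderiv ℝ σ y w v) α

/-- `s₁ = (h₁ + 3) + i h₃`. -/
def s₁ : ℂ := ((T.h₁ : ℂ) + 3) + I * (T.h₃ : ℂ)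

/-- `s₂ = h₂ + i h₄`. -/
def s₂ : ℂ := (T.h₂ : ℂ) + I * (T.h₄ : ℂ)

/-- Type III: `⟨q₁, q₂⟩ = ⟨s₂, s₁⟩ = 0` and `(q₁, q₂, s₁, s₂) ≠ (0, 0, 0, 0)`. -/
def IsTypeIII : Prop :=
  (T.q₁ * (starRingEnd ℂ) T.q₂).re = 0 ∧ (T.s₂ * (starRingEnd ℂ) T.s₁).re = 0 ∧
    ¬ (T.q₁ = 0 ∧ T.q₂ = 0 ∧ T.s₁ = 0 ∧ T.s₂ = 0)

end Torsion

/-- The values of the invariants `u, v, v̂, z, w, t₁` of a Type III structure with `t₂ ≠ 0`, in the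
normalization `t₂ = 1`. -/
structure TypeIIIInvariants where
  (u v vhat z w : ℂ)
  (t₁ : ℝ)

namespace TypeIIIInvariants

/-- The invariants `N` are those of the torsion `T`. -/
structure Of (N : TypeIIIInvariants) (T : Torsion) : Prop where
  q₁ : T.q₁ = I * (N.t₁ : ℂ) * N.z
  q₂ : T.q₂ = N.z
  s₂ : T.s₂ = I * (N.t₁ : ℂ) * N.w
  s₁ : T.s₁ = N.w
  p₁ : T.p₁ + 4 * I * T.p₄ = 6 * N.u
  p₂ : T.p₂ = - 6 * (N.t₁ : ℂ) * N.u
  v : T.p₃ + 4 * T.p₄ = 24 * N.v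
  vhat : - T.p₃ + 4 * T.p₄ = 24 * N.vhat

/-- `a₁ = 24 Re v`. -/
def a₁ (N : TypeIIIInvariants) : ℝ := 24 * N.v.re

/-- `a₂ = 24 Im v`. -/
def a₂ (N : TypeIIIInvariants) : ℝ := 24 * N.v.im

/-- `a₀ = 3 t₁`. -/
def a₀ (N : TypeIIIInvariants) : ℝ := 3 * N.t₁

end TypeIIIInvariants

/-- The cohomogeneity-two structure `(Ω, Υ)` on `U`, with orbit tangent spaces `W`, is of Type III
with `u = 0`, at all points of the bundle `P` over `U`. -/
def IsTypeIIIWithUZero (U : Set R6) (Ω : TwoForm) (Υ : ThreeFormC)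
    (W : R6 → Submodule ℝ R6) : Prop :=
  ∀ y ∈ U, ∀ f : R6 →L[ℝ] R6, IsO2Coframe Ω Υ W y f →
    ∃ (T : Torsion) (N : TypeIIIInvariants),
      T.IsAt Ω Υ W y f ∧ T.IsTypeIII ∧ N.Of T ∧ N.u = 0

end NK

end

/-! The structure is built explicitly on `ℍˣ × ℝ²`, with `ℍˣ` acting by left multiplication on the
first factor. The Lie algebra is `ℍ` with the commutator: the real axis is central and the imaginary
quaternions form `𝔰𝔲(2)`.

All torsion functions are taken to vanish except `p₃ = a₁ + i a₂` and `h₄ = a₀`. The structure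
equations become `ReducedEquations`, and these imply the nearly-Kähler equations by pointwise
algebra (`isNearlyKahlerOn_of_reducedEquations`). They are `O(2)`-equivariant, and the
`O(2)`-coframes at a point form one `O(2)`-orbit (`exists_orth`), so a single section of `P`
controls the torsion on all of `P`.

Put `β = α + ω³ - a₀ ω⁶`. The forms `(3ω⁴ - a₀ω¹ - a₂ω⁶)/2`, `(3ω⁵ - a₀ω² + a₁ω⁶)/2` and `(3ω³ - β -
a₀ω⁶)/2` are taken to be the imaginary components of `g⁻¹dg` on `ℍˣ` (`reducedEquations_of_base`).
With `η = ω¹ + iω²`, `a = a₁ + ia₂` and `κ = a₁ω¹ + a₂ω²`, there remain the equations `dη = iβ∧η`,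
`dβ = 3(1 + a₀²) ω¹∧ω²`, `da = iaβ + (a₀² - 3)η - aκ`, `da₀ = -2a₀κ` on the orbit space, and `dω⁶ =
-2a₀ ω¹∧ω² + κ∧ω⁶`.

They have rotationally symmetric solutions. Let `ζ = X + iY`, `N = |ζ|²` and `ζ̄ dζ = ν + iτ`, and
set `η = g dζ + kζν`, `β = cτ`, `a = hζ`, `ω⁶ = q(Re(g⁻¹dg) + mτ)`, where `g⁻¹dg` is the
Maurer-Cartan form and the other coefficients depend on `N` alone. The system becomes ordinary
differential equations in `N`, solved in closed form through `√(1 + 3N)` and `√(1 + s²N)`; the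
parameter `s` is the value of `a₀` at `N = 0`. The solution is smooth over the whole plane. The
numbers `s, X, Y` can be chosen to give `(a₁, a₂, a₀)` any value (`exists_invariants`), and a
translation moves the corresponding point to `x`. -/

noncomputable section

namespace NK

/-! ### The Lie algebra of the unit group of a Banach algebra -/

section Units

open VectorField

variable {R : Type*} [NormedRing R] [NormedAlgebra ℝ R] [CompleteSpace R]

/-- The chart of `Rˣ` is the inclusion into `R`, so its differential is the identity of `R`. -/
lemma hasMFDerivAt_unitsVal (g : Rˣ) :
    HasMFDerivAt 𝓘(ℝ, R) 𝓘(ℝ, R) (Units.val : Rˣ → R) g (ContinuousLinearMap.id ℝ R) := by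
  refine ⟨Units.continuous_val.continuousAt, ?_⟩
  have h : (writtenInExtChartAt 𝓘(ℝ, R) 𝓘(ℝ, R) g (Units.val : Rˣ → R)) =ᶠ[𝓝 (g : R)] id := by
    filter_upwards [Units.isOpenEmbedding_val.isOpen_range.mem_nhds (mem_range_self g)] with x hx
    obtain ⟨k, rfl⟩ := hx
    have : (extChartAt 𝓘(ℝ, R) g).symm (extChartAt 𝓘(ℝ, R) g k) = k :=
      (extChartAt 𝓘(ℝ, R) g).left_inv (by simp)
    exact congrArg Units.val this
  exact (((hasFDerivAt_id (𝕜 := ℝ) (g : R)).congr_of_eventuallyEq h)).hasFDerivWithinAt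

/-- The vector field `x ↦ x v` on the algebra `R`. -/
def mulRightField (v x : R) : TangentSpace 𝓘(ℝ, R) x := (x * v : R)

/-- An element of `R`, seen in the Lie algebra of `Rˣ`. -/
def toLie (v : R) : GroupLieAlgebra 𝓘(ℝ, R) Rˣ := v

/-- `Units.val` intertwines left translation on `Rˣ` with the linear map `x ↦ g x` on `R`, and its
own differential is the identity; uniqueness of the derivative does the rest. -/
lemma mulInvariantVectorField_units (v : R) (g : Rˣ) :
    mulInvariantVectorField (toLie v) g = mulRightField v (g : R) := by
  have h1 : MDifferentiableAt 𝓘(ℝ, R) 𝓘(ℝ, R) (fun x : Rˣ => g * x) 1 :=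
    (contMDiff_mul_left (I := 𝓘(ℝ, R)) (n := 1) (a := g)).mdifferentiableAt (by simp)
  have h2 := (hasMFDerivAt_unitsVal (g * 1)).comp 1 h1.hasMFDerivAt
  have h3 : HasMFDerivAt 𝓘(ℝ, R) 𝓘(ℝ, R) (fun x : R => (g : R) * x) ((1 : Rˣ) : R)
      (ContinuousLinearMap.mul ℝ R (g : R)) :=
    (ContinuousLinearMap.mul ℝ R (g : R)).hasFDerivAt.hasMFDerivAt
  have h4 := h3.comp (1 : Rˣ) (hasMFDerivAt_unitsVal (1 : Rˣ))
  have := hasMFDerivAt_unique h2 h4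
  exact congrArg (fun L : R →L[ℝ] R => L v) this

lemma mpullback_mulRightField (v : R) :
    mpullback 𝓘(ℝ, R) 𝓘(ℝ, R) (Units.val : Rˣ → R) (mulRightField v) =
      mulInvariantVectorField (toLie v) := by
  funext g
  refine Eq.trans ?_ (mulInvariantVectorField_units v g).symm
  rw [mpullback_apply, (hasMFDerivAt_unitsVal g).mfderiv]
  exact congrArg (fun L : R →L[ℝ] R => L ((g : R) * v)) ContinuousLinearMap.inverse_id

/-- The Lie algebra of `Rˣ` is `R` with the commutator bracket. -/
lemma bracket_units (v w : R) : ⁅toLie v, toLie w⁆ = toLie (v * w - w * v) := by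
  have hd : ∀ v : R, HasFDerivAt (mulRightField v) ((ContinuousLinearMap.mul ℝ R).flip v)
      ((1 : Rˣ) : R) := fun v => ((ContinuousLinearMap.mul ℝ R).flip v).hasFDerivAt
  have hm : ∀ v : R, MDifferentiableAt 𝓘(ℝ, R) 𝓘(ℝ, R).tangent
      (fun x : R => (mulRightField v x : TangentBundle 𝓘(ℝ, R) R)) ((1 : Rˣ) : R) := by
    intro v
    have : ContDiffAt ℝ 1 (mulRightField v) ((1 : Rˣ) : R) :=
      ((ContinuousLinearMap.mul ℝ R).flip v).contDiff.contDiffAt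
    exact (contMDiffAt_vectorSpace_iff_contDiffAt.2 this).mdifferentiableAt (by simp)
  -- Brackets commute with pull-back along `Units.val`, so the bracket can be computed for linear
  -- vector fields on `R`.
  have hp := mpullback_mlieBracket (n := minSmoothness ℝ 2) (hm v) (hm w)
    (Units.contMDiff_val (𝕜 := ℝ)).contMDiffAt le_rfl
  rw [mpullback_mulRightField, mpullback_mulRightField] at hp
  rw [GroupLieAlgebra.bracket_def]
  refine hp.symm.trans ?_
  rw [mpullback_apply, (hasMFDerivAt_unitsVal (1 : Rˣ)).mfderiv, ← mlieBracketWithin_univ,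
    mlieBracketWithin_eq_lieBracketWithin]
  refine (congrArg (fun L : R →L[ℝ] R => L _) ContinuousLinearMap.inverse_id).trans ?_
  change lieBracketWithin ℝ (fun x : R => x * v) (fun x : R => x * w) univ ((1 : Rˣ) : R) = _
  rw [lieBracketWithin_univ, lieBracket_eq]
  change fderiv ℝ (mulRightField w) ((1 : Rˣ) : R) (mulRightField v _) -
    fderiv ℝ (mulRightField v) ((1 : Rˣ) : R) (mulRightField w _) = _
  rw [(hd v).fderiv, (hd w).fderiv]
  change ((1 : Rˣ) * v : R) * w - ((1 : Rˣ) * w : R) * v = v * w - w * v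
  rw [Units.val_one, one_mul, one_mul]

end Units

/-! ### The quaternions as `𝔰𝔲(2) ⊕ 𝔲(1)` -/

section QuaternionLieAlgebra

open Quaternion
attribute [local instance] LieRing.ofAssociativeRing

/-- The image in `𝔰𝔲(2)` of the imaginary part of a quaternion. -/
def quatMat (p : ℍ[ℝ]) : Matrix (Fin 2) (Fin 2) ℂ :=
  !![⟨0, p.imI⟩, ⟨p.imJ, p.imK⟩; ⟨-p.imJ, p.imK⟩, ⟨0, -p.imI⟩]

lemma quatMat_mem (p : ℍ[ℝ]) : quatMat p ∈ su 2 := by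
  refine ⟨?_, ?_⟩
  · ext i j
    fin_cases i <;> fin_cases j <;> simp [quatMat, Matrix.conjTranspose_apply, Complex.ext_iff]
  · simp [quatMat, Matrix.trace_fin_two, Complex.ext_iff]

/-- The image in `𝔲(1)` of the real part of a quaternion. -/
def quatRe (p : ℍ[ℝ]) : Matrix (Fin 1) (Fin 1) ℂ := !![⟨0, p.re⟩]

lemma quatRe_mem (p : ℍ[ℝ]) : quatRe p ∈ u 1 := by
  change (quatRe p)ᴴ = -quatRe p
  ext i j
  fin_cases i; fin_cases j
  simp [quatRe, Matrix.conjTranspose_apply, Complex.ext_iff]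

/-- The isomorphism `ℍ ≅ 𝔰𝔲(2) ⊕ 𝔲(1)`. -/
def quatEquiv : ℍ[ℝ] ≃ₗ[ℝ] (su 2 × u 1) where
  toFun p := (⟨quatMat p, quatMat_mem p⟩, ⟨quatRe p, quatRe_mem p⟩)
  map_add' p q := by
    refine Prod.ext (Subtype.ext ?_) (Subtype.ext ?_)
    · change quatMat (p + q) = quatMat p + quatMat q
      ext i j
      fin_cases i <;> fin_cases j <;> simp [quatMat, Complex.ext_iff, add_comm]
    · change quatRe (p + q) = quatRe p + quatRe q
      ext i j
      fin_cases i; fin_cases j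
      simp [quatRe, Complex.ext_iff]
  map_smul' c p := by
    refine Prod.ext (Subtype.ext ?_) (Subtype.ext ?_)
    · change quatMat (c • p) = c • quatMat p
      ext i j
      fin_cases i <;> fin_cases j <;> simp [quatMat, Complex.ext_iff]
    · change quatRe (c • p) = c • quatRe p
      ext i j
      fin_cases i; fin_cases j
      simp [quatRe, Complex.ext_iff]
  invFun m := ⟨(m.2.1 0 0).im, (m.1.1 0 0).im, (m.1.1 0 1).re, (m.1.1 0 1).im⟩
  left_inv p := by ext <;> simp [quatMat, quatRe]
  right_inv m := by
    obtain ⟨⟨A, hA, hA'⟩, ⟨B, hB⟩⟩ := m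
    change Bᴴ = -B at hB
    have a00 := congrFun (congrFun hA 0) 0
    have a01 := congrFun (congrFun hA 0) 1
    have b00 := congrFun (congrFun hB 0) 0
    rw [Matrix.trace_fin_two] at hA'
    simp only [Matrix.conjTranspose_apply, Matrix.neg_apply, Complex.ext_iff, Complex.star_def,
      conj_re, conj_im, neg_re, neg_im, add_re, add_im, zero_re, zero_im] at a00 a01 b00 hA'
    refine Prod.ext (Subtype.ext ?_) (Subtype.ext ?_)
    · ext i j
      fin_cases i <;> fin_cases j <;> simp [quatMat, Complex.ext_iff] <;>
        first | (constructor <;> linarith) | linarith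
    · ext i j
      fin_cases i; fin_cases j
      simp [quatRe, Complex.ext_iff]
      linarith

/-- Real quaternions are central and a commutator has no real part, while on imaginary quaternions
`quatMat` is the standard representation by 2×2 matrices. -/
lemma quatEquiv_bracket (p q : ℍ[ℝ]) :
    quatEquiv (p * q - q * p) = ⁅quatEquiv p, quatEquiv q⁆ := by
  refine Prod.ext (Subtype.ext ?_) (Subtype.ext ?_)
  · change quatMat (p * q - q * p) = ⁅quatMat p, quatMat q⁆
    rw [LieRing.of_associative_ring_bracket]
    ext i j
    fin_cases i <;> fin_cases j <;>
      simp [quatMat, Complex.ext_iff] <;>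
      constructor <;> ring
  · change quatRe (p * q - q * p) = ⁅quatRe p, quatRe q⁆
    rw [LieRing.of_associative_ring_bracket]
    ext i j
    fin_cases i; fin_cases j
    simp [quatRe, Complex.ext_iff]
    constructor <;> ring

theorem hasLieAlgebraSU2U1_quaternion_units : HasLieAlgebraSU2U1 ℍ[ℝ] ℍ[ℝ]ˣ := by
  refine ⟨quatEquiv, fun X Y => ?_⟩
  refine (congrArg quatEquiv (bracket_units (R := ℍ[ℝ]) X Y)).trans ?_
  exact quatEquiv_bracket X Y

end QuaternionLieAlgebra

/-! ### The reduced torsion and its structure equations -/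

section StructureEquations

/-- The wedge product of the components `i` and `j` of a coframe, evaluated on `v, w`. -/
def cw (f : R6 →L[ℝ] R6) (i j : Fin 6) (v w : R6) : ℝ := f v i * f w j - f w i * f v j

/-- The wedge product of a covector with the component `j` of a coframe, evaluated on `v, w`. -/
def lw (β : R6 →ₗ[ℝ] ℝ) (f : R6 →L[ℝ] R6) (j : Fin 6) (v w : R6) : ℝ := β v * f w j - β w * f v j

/-- The structure equations of the Type III structures with `u = 0`, in real form, where
`β = α + ω³ - a₀ ω⁶`. -/
structure ReducedEquations (f : R6 →L[ℝ] R6) (df : R6 → R6 → R6) (β : R6 →ₗ[ℝ] ℝ)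
    (a₁ a₂ a₀ : ℝ) : Prop where
  d0 : ∀ v w, df v w 0 = - lw β f 1 v w
  d1 : ∀ v w, df v w 1 = lw β f 0 v w
  d2 : ∀ v w, df v w 2 = cw f 0 1 v w + a₀ * (cw f 0 4 v w - cw f 1 3 v w) - 3 * cw f 3 4 v w
    - (a₁ * cw f 3 5 v w + a₂ * cw f 4 5 v w)
  d3 : ∀ v w, df v w 3 = a₀ * cw f 1 2 v w - cw f 1 5 v w - lw β f 4 v w - 3 * cw f 4 2 v w
    + a₀ * cw f 4 5 v w + a₁ * cw f 2 5 v w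
  d4 : ∀ v w, df v w 4 = - a₀ * cw f 0 2 v w + cw f 0 5 v w + lw β f 3 v w + 3 * cw f 3 2 v w
    - a₀ * cw f 3 5 v w + a₂ * cw f 2 5 v w
  d5 : ∀ v w, df v w 5 = - 2 * a₀ * cw f 0 1 v w + (a₁ * cw f 0 5 v w + a₂ * cw f 1 5 v w)

/-- The torsion of a Type III structure with `u = 0`. -/
def reducedTorsion (a₁ a₂ a₀ : ℝ) : Torsion where
  p₁ := 0
  p₂ := 0
  p₃ := ⟨a₁, a₂⟩
  p₄ := 0
  q₁ := 0
  q₂ := 0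
  r := 0
  h₁ := 0
  h₂ := 0
  h₃ := 0
  h₄ := a₀

/-- The invariants of a Type III structure with `u = 0`. -/
def reducedInvariants (a₁ a₂ a₀ : ℝ) : TypeIIIInvariants where
  u := 0
  v := ⟨a₁ / 24, a₂ / 24⟩
  vhat := ⟨-(a₁ / 24), -(a₂ / 24)⟩
  z := 0
  -- `s₁ = (h₁ + 3) + i h₃` with `h₁ = h₃ = 0`; then `s₂ = i a₀ = i t₁ w` forces `t₁ = a₀ / 3`.
  w := 3
  t₁ := a₀ / 3

lemma reducedInvariants_of (a₁ a₂ a₀ : ℝ) :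
    (reducedInvariants a₁ a₂ a₀).Of (reducedTorsion a₁ a₂ a₀) where
  q₁ := by simp [reducedInvariants, reducedTorsion]
  q₂ := by simp [reducedInvariants, reducedTorsion]
  s₂ := by
    simp [reducedInvariants, reducedTorsion, Torsion.s₂, Complex.ext_iff]
  s₁ := by simp [reducedInvariants, reducedTorsion, Torsion.s₁]
  p₁ := by simp [reducedInvariants, reducedTorsion]
  p₂ := by simp [reducedInvariants, reducedTorsion]
  v := by
    simp [reducedInvariants, reducedTorsion, Complex.ext_iff]
    constructor <;> ring
  vhat := by
    simp [reducedInvariants, reducedTorsion, Complex.ext_iff]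
    constructor <;> ring

lemma reducedTorsion_isTypeIII (a₁ a₂ a₀ : ℝ) : (reducedTorsion a₁ a₂ a₀).IsTypeIII := by
  refine ⟨by simp [reducedTorsion], by simp [reducedTorsion, Torsion.s₁, Torsion.s₂], ?_⟩
  rintro ⟨-, -, h, -⟩
  simp [reducedTorsion, Torsion.s₁] at h

/-- The connection form `α` in terms of `β`. -/
def connectionForm (f : R6 →L[ℝ] R6) (β : R6 →ₗ[ℝ] ℝ) (a₀ : ℝ) : R6 →ₗ[ℝ] ℝ where
  toFun v := β v - f v 2 + a₀ * f v 5
  map_add' v w := by simp; ring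
  map_smul' c v := by simp; ring

lemma ReducedEquations.structureEquations {f : R6 →L[ℝ] R6} {df : R6 → R6 → R6}
    {β : R6 →ₗ[ℝ] ℝ} {a₁ a₂ a₀ : ℝ} (h : ReducedEquations f df β a₁ a₂ a₀) :
    (reducedTorsion a₁ a₂ a₀).StructureEquations f df (connectionForm f β a₀) where
  d_eta v w := by
    rw [h.d0, h.d1]
    simp [Complex.ext_iff, wedge, cbar, eta, theta, omega3, omega6, Torsion.xi₀, Torsion.xi₁,
      Torsion.xi₂, Torsion.xi₃, reducedTorsion, connectionForm, lw]
    constructor <;> ring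
  d_omega3 v w := by
    rw [h.d2]
    simp [Complex.ext_iff, wedge, cbar, eta, theta, omega3, omega6, Torsion.xi₀, Torsion.xi₁,
      Torsion.xi₂, reducedTorsion, cw]
    constructor <;> ring
  d_theta v w := by
    rw [h.d3, h.d4]
    simp [Complex.ext_iff, wedge, cbar, eta, theta, omega3, omega6, Torsion.xi₀, Torsion.xi₁,
      Torsion.xi₂, Torsion.xi₃, reducedTorsion, connectionForm, lw, cw]
    constructor <;> ring
  d_omega6 v w := by
    rw [h.d5]
    simp [Complex.ext_iff, wedge, cbar, eta, theta, omega3, omega6, Torsion.xi₀, Torsion.xi₁,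
      Torsion.xi₂, reducedTorsion, cw]
    constructor <;> ring

end StructureEquations

/-! ### Pull-backs of the model forms by a coframing -/

section Forms

/-- The standard 2-form on `ℝ⁶` as an alternating map. -/
def stdOmegaForm : R6 [⋀^Fin 2]→L[ℝ] ℝ where
  toFun v := stdOmega (v 0) (v 1)
  map_update_add' v i x y := by
    -- The field quantifies over every decidability instance; the canonical one lets
    -- `Function.update` compute.
    have : ‹DecidableEq (Fin 2)› = instDecidableEqFin 2 := Subsingleton.elim _ _
    subst this
    fin_cases i <;> simp [stdOmega] <;> ring
  map_update_smul' v i c x := by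
    have : ‹DecidableEq (Fin 2)› = instDecidableEqFin 2 := Subsingleton.elim _ _
    subst this
    fin_cases i <;> simp [stdOmega] <;> ring
  cont := by
    unfold stdOmega
    fun_prop
  map_eq_zero_of_eq' v i j h hij := by
    fin_cases i <;> fin_cases j <;> simp_all [stdOmega] <;> ring

lemma stdUpsilon_eq (v : Fin 3 → R6) : stdUpsilon v =
    zCoord (v 0) 0 * zCoord (v 1) 1 * zCoord (v 2) 2
    - zCoord (v 1) 0 * zCoord (v 0) 1 * zCoord (v 2) 2
    + zCoord (v 1) 0 * zCoord (v 2) 1 * zCoord (v 0) 2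
    - zCoord (v 0) 0 * zCoord (v 2) 1 * zCoord (v 1) 2
    - zCoord (v 2) 0 * zCoord (v 1) 1 * zCoord (v 0) 2
    + zCoord (v 2) 0 * zCoord (v 0) 1 * zCoord (v 1) 2 := by
  simp only [stdUpsilon, Matrix.det_fin_three, Matrix.of_apply]
  ring

lemma zCoord_add (v w : R6) (i : Fin 3) : zCoord (v + w) i = zCoord v i + zCoord w i := by
  fin_cases i <;> simp [zCoord] <;> ring

lemma zCoord_smul (c : ℝ) (v : R6) (i : Fin 3) : zCoord (c • v) i = c * zCoord v i := by
  fin_cases i <;> simp [zCoord] <;> ring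

lemma continuous_zCoord (i : Fin 3) : Continuous fun v : R6 => zCoord v i := by
  fin_cases i <;> simp only [zCoord] <;> simp <;> fun_prop

/-- The standard complex volume form on `ℝ⁶` as an alternating map. -/
def stdUpsilonForm : R6 [⋀^Fin 3]→L[ℝ] ℂ where
  toFun v := stdUpsilon v
  map_update_add' v i x y := by
    have : ‹DecidableEq (Fin 3)› = instDecidableEqFin 3 := Subsingleton.elim _ _
    subst this
    rw [stdUpsilon_eq, stdUpsilon_eq, stdUpsilon_eq]
    fin_cases i <;> simp [zCoord_add, Function.update_of_ne] <;> ring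
  map_update_smul' v i c x := by
    have : ‹DecidableEq (Fin 3)› = instDecidableEqFin 3 := Subsingleton.elim _ _
    subst this
    rw [stdUpsilon_eq, stdUpsilon_eq]
    fin_cases i <;> simp [zCoord_smul, Function.update_of_ne] <;> ring
  cont := by
    have h : ∀ i j, Continuous fun v : Fin 3 → R6 => zCoord (v i) j :=
      fun i j => (continuous_zCoord j).comp (continuous_apply i)
    refine Continuous.congr ?_ fun v => (stdUpsilon_eq v).symm
    fun_prop
  map_eq_zero_of_eq' v i j h hij := by
    rw [stdUpsilon_eq]
    fin_cases i <;> fin_cases j <;> simp_all <;> ring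

lemma stdOmegaForm_apply (v : Fin 2 → R6) : stdOmegaForm v = stdOmega (v 0) (v 1) := rfl

lemma stdUpsilonForm_apply (v : Fin 3 → R6) : stdUpsilonForm v = stdUpsilon v := rfl

/-- The 2-form for which `σ` is a field of `SU(3)`-coframes. -/
def omegaOf (σ : R6 → R6 →L[ℝ] R6) : TwoForm :=
  fun y => stdOmegaForm.compContinuousLinearMap (σ y)

/-- The complex 3-form for which `σ` is a field of `SU(3)`-coframes. -/
def upsilonOf (σ : R6 → R6 →L[ℝ] R6) : ThreeFormC :=
  fun y => stdUpsilonForm.compContinuousLinearMap (σ y)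

lemma isSU3Coframe_of (σ : R6 → R6 →L[ℝ] R6) {y : R6} (h : Function.Bijective (σ y)) :
    IsSU3Coframe (omegaOf σ) (upsilonOf σ) y (σ y) :=
  ⟨h, fun _ => rfl, fun _ => rfl⟩

variable {F : Type*} [NormedAddCommGroup F] [NormedSpace ℝ F]

/-- A form with smooth values on constant vectors is smooth. -/
lemma contDiffOn_form {k : ℕ} {φ : R6 → R6 [⋀^Fin k]→L[ℝ] F} {U : Set R6} [FiniteDimensional ℝ F]
    (h : ∀ v, ContDiffOn ℝ ∞ (fun y => φ y v) U) : ContDiffOn ℝ ∞ φ U := by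
  let b := (EuclideanSpace.basisFun (Fin 6) ℝ).toBasis
  let ev : (R6 [⋀^Fin k]→L[ℝ] F) →ₗ[ℝ] ((Fin k → Fin 6) → F) :=
    { toFun := fun m s => m (fun i => b (s i))
      map_add' := fun _ _ => rfl
      map_smul' := fun _ _ => rfl }
  have hinj : Function.Injective ev := by
    intro m n hmn
    apply ContinuousAlternatingMap.toAlternatingMap_injective
    apply AlternatingMap.coe_multilinearMap_injective
    exact Module.Basis.ext_multilinear (fun _ => b) fun s => congrFun hmn s
  -- A linear left inverse of evaluation on basis tuples expresses `φ` as a fixed linear image of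
  -- finitely many smooth functions.
  obtain ⟨L, hL⟩ := ev.exists_leftInverse_of_injective (LinearMap.ker_eq_bot.2 hinj)
  have hφ : φ = fun y => LinearMap.toContinuousLinearMap L (fun s => φ y (fun i => b (s i))) := by
    funext y
    exact (LinearMap.congr_fun hL (φ y)).symm
  rw [hφ]
  exact (LinearMap.toContinuousLinearMap L).contDiff.comp_contDiffOn
    (contDiffOn_pi.2 fun s => h _)

lemma contDiffOn_pullback {k : ℕ} [FiniteDimensional ℝ F] (M : R6 [⋀^Fin k]→L[ℝ] F)
    {σ : R6 → R6 →L[ℝ] R6} {U : Set R6} (hσ : ContDiffOn ℝ ∞ σ U) :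
    ContDiffOn ℝ ∞ (fun y => M.compContinuousLinearMap (σ y)) U := by
  refine contDiffOn_form fun v => ?_
  exact M.toContinuousMultilinearMap.contDiff.comp_contDiffOn
    (contDiffOn_pi.2 fun i => hσ.clm_apply contDiffOn_const)

/-- The exterior derivative of the pull-back of a constant form by a coframing. -/
lemma extDeriv_pullback_apply {k : ℕ} (M : R6 [⋀^Fin k]→L[ℝ] F) {σ : R6 → R6 →L[ℝ] R6} {y : R6}
    (hσ : DifferentiableAt ℝ σ y) (v : Fin (k + 1) → R6) :
    extDeriv (fun z => M.compContinuousLinearMap (σ z)) y v =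
      ∑ i, (-1) ^ i.val • ∑ j, M (Function.update (fun l => σ y (i.removeNth v l)) j
        (fderiv ℝ σ y (v i) (i.removeNth v j))) := by
  have hd : DifferentiableAt ℝ (fun z => M.compContinuousLinearMap (σ z)) y :=
    (differentiableAt_const M).continuousAlternatingMapCompContinuousLinearMap hσ
  rw [extDeriv_apply hd]
  refine Finset.sum_congr rfl fun i _ => ?_
  congr 1
  have h1 : HasFDerivAt (fun z l => σ z (i.removeNth v l))
      (ContinuousLinearMap.pi fun l => (fderiv ℝ σ y).flip (i.removeNth v l)) y :=
    hasFDerivAt_pi.2 fun l => by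
      simpa using hσ.hasFDerivAt.clm_apply (hasFDerivAt_const (i.removeNth v l) y)
  have h2 := (M.hasFDerivAt (fun l => σ y (i.removeNth v l))).comp y h1
  change fderiv ℝ (M ∘ fun z l => σ z (i.removeNth v l)) y (v i) = _
  rw [h2.fderiv]
  simp only [ContinuousLinearMap.comp_apply, ContinuousMultilinearMap.linearDeriv_apply]
  rfl

end Forms

/-! ### The reduced equations imply the nearly-Kähler equations -/

section NearlyKahler

variable {σ : R6 → R6 →L[ℝ] R6} {y : R6} {β : R6 →ₗ[ℝ] ℝ} {a₁ a₂ a₀ : ℝ}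

/-- The exterior derivative of the coframing `σ` at `y`. -/
def dCoframe (σ : R6 → R6 →L[ℝ] R6) (y v w : R6) : R6 := fderiv ℝ σ y v w - fderiv ℝ σ y w v

/-- The Leibniz rule gives six terms, which pair off by antisymmetry into values of the exterior
derivative of the coframing. `extDeriv_upsilonOf` is the analogue with twelve terms. -/
lemma extDeriv_omegaOf (hσ : DifferentiableAt ℝ σ y) (v : Fin 3 → R6) :
    extDeriv (omegaOf σ) y v =
      stdOmega (dCoframe σ y (v 0) (v 1)) (σ y (v 2))
      - stdOmega (dCoframe σ y (v 0) (v 2)) (σ y (v 1))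
      + stdOmega (dCoframe σ y (v 1) (v 2)) (σ y (v 0)) := by
  unfold omegaOf
  rw [extDeriv_pullback_apply stdOmegaForm hσ v]
  simp [Fin.sum_univ_succ, stdOmegaForm_apply, Fin.removeNth, stdOmega, dCoframe]
  ring

lemma zCoord_sub (v w : R6) (i : Fin 3) : zCoord (v - w) i = zCoord v i - zCoord w i := by
  fin_cases i <;> simp [zCoord] <;> ring

/-- The exterior derivative of the complex volume form in terms of that of the coframing. -/
def dUpsilon (f : R6 →L[ℝ] R6) (df : R6 → R6 → R6) (v : Fin 4 → R6) : ℂ :=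
  stdUpsilon ![df (v 0) (v 1), f (v 2), f (v 3)] - stdUpsilon ![df (v 0) (v 2), f (v 1), f (v 3)]
  + stdUpsilon ![df (v 0) (v 3), f (v 1), f (v 2)] + stdUpsilon ![df (v 1) (v 2), f (v 0), f (v 3)]
  - stdUpsilon ![df (v 1) (v 3), f (v 0), f (v 2)] + stdUpsilon ![df (v 2) (v 3), f (v 0), f (v 1)]

lemma extDeriv_upsilonOf (hσ : DifferentiableAt ℝ σ y) (v : Fin 4 → R6) :
    extDeriv (upsilonOf σ) y v = dUpsilon (σ y) (dCoframe σ y) v := by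
  unfold upsilonOf
  rw [extDeriv_pullback_apply stdUpsilonForm hσ v]
  have h1 : Fin.succAbove (1 : Fin 4) (2 : Fin 3) = 3 := rfl
  have h2 : Fin.succAbove (2 : Fin 4) (2 : Fin 3) = 3 := rfl
  have h3 : Fin.succAbove (3 : Fin 4) (2 : Fin 3) = 2 := rfl
  simp [h1, h2, h3, Fin.sum_univ_succ, stdUpsilonForm_apply, Fin.removeNth, stdUpsilon_eq, dCoframe, dUpsilon,
    zCoord_sub, Function.update_of_ne]
  ring

lemma extDeriv_rePart (hσ : DifferentiableAt ℝ σ y) (v : Fin 4 → R6) :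
    extDeriv (rePart (upsilonOf σ)) y v = (extDeriv (upsilonOf σ) y v).re := by
  have h1 := extDeriv_pullback_apply stdUpsilonForm hσ v
  have h2 := extDeriv_pullback_apply
    (Complex.reCLM.compContinuousAlternatingMap stdUpsilonForm) hσ v
  unfold upsilonOf
  rw [h1, Complex.re_sum]
  refine h2.trans (Finset.sum_congr rfl fun i _ => ?_)
  rw [Complex.smul_re, Complex.re_sum]
  rfl

lemma extDeriv_imPart (hσ : DifferentiableAt ℝ σ y) (v : Fin 4 → R6) :
    extDeriv (imPart (upsilonOf σ)) y v = (extDeriv (upsilonOf σ) y v).im := by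
  have h1 := extDeriv_pullback_apply stdUpsilonForm hσ v
  have h2 := extDeriv_pullback_apply
    (Complex.imCLM.compContinuousAlternatingMap stdUpsilonForm) hσ v
  unfold upsilonOf
  rw [h1, Complex.im_sum]
  refine h2.trans (Finset.sum_congr rfl fun i _ => ?_)
  rw [Complex.smul_im, Complex.im_sum]
  rfl

/-- The form `β` enters as a simultaneous rotation of `(ω¹, ω²)` and `(ω⁴, ω⁵)`, an infinitesimal
element of `SU(3)`, and drops out. The `aᵢ` cancel too, and their differentials never enter: the
identity is pointwise. -/
lemma ReducedEquations.d_omega (h : ReducedEquations (σ y) (dCoframe σ y) β a₁ a₂ a₀)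
    (hσ : DifferentiableAt ℝ σ y) : extDeriv (omegaOf σ) y = (3 : ℝ) • imPart (upsilonOf σ) y := by
  ext v
  rw [extDeriv_omegaOf hσ]
  change _ = 3 * (stdUpsilon fun i => σ y (v i)).im
  rw [stdUpsilon_eq]
  simp only [stdOmega, h.d0, h.d1, h.d2, h.d3, h.d4, h.d5]
  simp [zCoord, cw, lw]
  ring

-- After substitution this is a polynomial identity in the components of four vectors. The factor
-- `4` is the `2` of `d Re Υ = 2 Ω ∧ Ω` times the `2` in `omegaSq`.
set_option maxHeartbeats 4000000 in
lemma ReducedEquations.d_upsilon_re {f : R6 →L[ℝ] R6} {df : R6 → R6 → R6}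
    (h : ReducedEquations f df β a₁ a₂ a₀) (v : Fin 4 → R6) :
    (dUpsilon f df v).re =
      4 * (stdOmega (f (v 0)) (f (v 1)) * stdOmega (f (v 2)) (f (v 3))
        - stdOmega (f (v 0)) (f (v 2)) * stdOmega (f (v 1)) (f (v 3))
        + stdOmega (f (v 0)) (f (v 3)) * stdOmega (f (v 1)) (f (v 2))) := by
  simp [dUpsilon, stdUpsilon_eq, zCoord, h.d0, h.d1, h.d2, h.d3, h.d4, h.d5, cw, lw, stdOmega]
  ring

set_option maxHeartbeats 4000000 in
lemma ReducedEquations.d_upsilon_im {f : R6 →L[ℝ] R6} {df : R6 → R6 → R6}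
    (h : ReducedEquations f df β a₁ a₂ a₀) (v : Fin 4 → R6) : (dUpsilon f df v).im = 0 := by
  simp [dUpsilon, stdUpsilon_eq, zCoord, h.d0, h.d1, h.d2, h.d3, h.d4, h.d5, cw, lw]
  ring

/-- A field of coframes that satisfies the reduced structure equations defines a nearly-Kähler
structure. -/
theorem isNearlyKahlerOn_of_reducedEquations {U : Set R6} (hU : IsOpen U)
    (hσ : ContDiffOn ℝ ∞ σ U) (hb : ∀ y ∈ U, Function.Bijective (σ y))
    (h : ∀ y ∈ U, ∃ β a₁ a₂ a₀, ReducedEquations (σ y) (dCoframe σ y) β a₁ a₂ a₀) :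
    IsNearlyKahlerOn U (omegaOf σ) (upsilonOf σ) where
  smooth_omega := contDiffOn_pullback _ hσ
  smooth_upsilon := contDiffOn_pullback _ hσ
  su3 y hy := ⟨σ y, isSU3Coframe_of σ (hb y hy)⟩
  d_omega y hy := by
    obtain ⟨β, a₁, a₂, a₀, he⟩ := h y hy
    exact he.d_omega ((hσ.contDiffAt (hU.mem_nhds hy)).differentiableAt (by simp))
  d_re y hy v := by
    obtain ⟨β, a₁, a₂, a₀, he⟩ := h y hy
    have hd := (hσ.contDiffAt (hU.mem_nhds hy)).differentiableAt (by simp)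
    rw [extDeriv_rePart hd, extDeriv_upsilonOf hd, he.d_upsilon_re, omegaSq]
    simp only [omegaOf, ContinuousAlternatingMap.compContinuousLinearMap_apply, stdOmegaForm_apply,
      Function.comp_apply, Matrix.cons_val_zero, Matrix.cons_val_one]
    ring
  d_im y hy := by
    obtain ⟨β, a₁, a₂, a₀, he⟩ := h y hy
    have hd := (hσ.contDiffAt (hU.mem_nhds hy)).differentiableAt (by simp)
    ext v
    rw [extDeriv_imPart hd, extDeriv_upsilonOf hd, he.d_upsilon_im]
    rfl

end NearlyKahler

/-! ### The action of `O(2)` on adapted coframes -/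

section OrthogonalGroup

/-- The element of `O(2) ⊂ SU(3)` with first column `(c, d)` and determinant `ε`. -/
def orth (c d ε : ℝ) : R6 →L[ℝ] R6 :=
  LinearMap.toContinuousLinearMap
    { toFun := fun v => !₂[c * v 0 - ε * d * v 1, d * v 0 + ε * c * v 1, ε * v 2,
        c * v 3 - ε * d * v 4, d * v 3 + ε * c * v 4, ε * v 5]
      map_add' := fun v w => by
        ext i
        fin_cases i <;> simp <;> ring
      map_smul' := fun a v => by
        ext i
        fin_cases i <;> simp <;> ring }

section
variable (c d ε : ℝ) (v : R6)
lemma orth_0 : orth c d ε v 0 = c * v 0 - ε * d * v 1 := rfl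
lemma orth_1 : orth c d ε v 1 = d * v 0 + ε * c * v 1 := rfl
lemma orth_2 : orth c d ε v 2 = ε * v 2 := rfl
lemma orth_3 : orth c d ε v 3 = c * v 3 - ε * d * v 4 := rfl
lemma orth_4 : orth c d ε v 4 = d * v 3 + ε * c * v 4 := rfl
lemma orth_5 : orth c d ε v 5 = ε * v 5 := rfl
end

variable {c d ε : ℝ}

lemma stdOmega_orth (h : c ^ 2 + d ^ 2 = 1) (hε : ε ^ 2 = 1) (v w : R6) :
    stdOmega (orth c d ε v) (orth c d ε w) = stdOmega v w := by
  simp only [stdOmega, orth_0, orth_1, orth_2, orth_3, orth_4, orth_5]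
  linear_combination (v 0 * w 3 - v 3 * w 0 + ε ^ 2 * (v 1 * w 4 - v 4 * w 1)) * h +
    (v 1 * w 4 - v 4 * w 1 + (v 2 * w 5 - v 5 * w 2)) * hε

/-- `orth` acts on `ℂ³` as the real matrix `diag(A, det A)` with `A ∈ O(2)`; its complex determinant
`(c² + d²) ε²` is `1`. -/
lemma stdUpsilon_orth (h : c ^ 2 + d ^ 2 = 1) (hε : ε ^ 2 = 1) (v : Fin 3 → R6) :
    stdUpsilon (fun i => orth c d ε (v i)) = stdUpsilon v := by
  have hz0 : ∀ x, zCoord (orth c d ε x) 0 = c * zCoord x 0 - ε * d * zCoord x 1 := by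
    intro x
    simp [zCoord, orth_0, orth_3]
    ring
  have hz1 : ∀ x, zCoord (orth c d ε x) 1 = d * zCoord x 0 + ε * c * zCoord x 1 := by
    intro x
    simp [zCoord, orth_1, orth_4]
    ring
  have hz2 : ∀ x, zCoord (orth c d ε x) 2 = ε * zCoord x 2 := by
    intro x
    simp [zCoord, orth_2, orth_5]
    ring
  have h' : (c : ℂ) ^ 2 + (d : ℂ) ^ 2 = 1 := by exact_mod_cast h
  have hε' : (ε : ℂ) ^ 2 = 1 := by exact_mod_cast hε
  have key : stdUpsilon (fun i => orth c d ε (v i)) =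
      ((c : ℂ) ^ 2 + (d : ℂ) ^ 2) * (ε : ℂ) ^ 2 * stdUpsilon v := by
    simp only [stdUpsilon_eq, hz0, hz1, hz2]
    ring
  rw [key, h', hε', one_mul, one_mul]

lemma orth_zero_iff (h : c ^ 2 + d ^ 2 = 1) (hε : ε ^ 2 = 1) (v : R6) :
    (orth c d ε v 0 = 0 ∧ orth c d ε v 1 = 0) ↔ v 0 = 0 ∧ v 1 = 0 := by
  rw [orth_0, orth_1]
  constructor
  · rintro ⟨h0, h1⟩
    constructor
    · linear_combination c * h0 + d * h1 - v 0 * h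
    · linear_combination -ε * d * h0 + ε * c * h1 - v 1 * ε ^ 2 * h - v 1 * hε
  · rintro ⟨h0, h1⟩
    rw [h0, h1]
    simp

lemma orth_bijective (h : c ^ 2 + d ^ 2 = 1) (hε : ε ^ 2 = 1) :
    Function.Bijective (orth c d ε) := by
  have hinj : Function.Injective (orth c d ε) := by
    refine (injective_iff_map_eq_zero _).2 fun v hv => ?_
    have e : ∀ i, orth c d ε v i = 0 := fun i => by rw [hv]; rfl
    have e0 := e 0
    have e1 := e 1
    have e2 := e 2
    have e3 := e 3
    have e4 := e 4
    have e5 := e 5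
    rw [orth_0] at e0
    rw [orth_1] at e1
    rw [orth_2] at e2
    rw [orth_3] at e3
    rw [orth_4] at e4
    rw [orth_5] at e5
    ext i
    fin_cases i
    · change v 0 = 0
      linear_combination c * e0 + d * e1 - v 0 * h
    · change v 1 = 0
      linear_combination -ε * d * e0 + ε * c * e1 - v 1 * ε ^ 2 * h - v 1 * hε
    · change v 2 = 0
      linear_combination ε * e2 - v 2 * hε
    · change v 3 = 0
      linear_combination c * e3 + d * e4 - v 3 * h
    · change v 4 = 0
      linear_combination -ε * d * e3 + ε * c * e4 - v 4 * ε ^ 2 * h - v 4 * hε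
    · change v 5 = 0
      linear_combination ε * e5 - v 5 * hε
  exact ⟨hinj, (LinearMap.injective_iff_surjective (f := (orth c d ε).toLinearMap)).1 hinj⟩

lemma IsO2Coframe.orth_comp {Ω : TwoForm} {Υ : ThreeFormC} {W : R6 → Submodule ℝ R6} {y : R6}
    {f : R6 →L[ℝ] R6} (hf : IsO2Coframe Ω Υ W y f) (h : c ^ 2 + d ^ 2 = 1) (hε : ε ^ 2 = 1) :
    IsO2Coframe Ω Υ W y (orth c d ε ∘L f) := by
  obtain ⟨⟨hb, hΩ, hΥ⟩, hW⟩ := hf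
  refine ⟨⟨(orth_bijective h hε).comp hb, fun v => ?_, fun v => ?_⟩, fun v => ?_⟩
  · exact (hΩ v).trans (stdOmega_orth h hε _ _).symm
  · exact (hΥ v).trans (stdUpsilon_orth h hε _).symm
  · exact (hW v).trans (orth_zero_iff h hε _).symm

/-- The reduced structure equations are equivariant under `O(2)`. -/
lemma ReducedEquations.orth_comp {f : R6 →L[ℝ] R6} {df : R6 → R6 → R6} {β : R6 →ₗ[ℝ] ℝ}
    {a₁ a₂ a₀ : ℝ} (H : ReducedEquations f df β a₁ a₂ a₀) (h : c ^ 2 + d ^ 2 = 1)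
    (hε : ε ^ 2 = 1) :
    ReducedEquations (orth c d ε ∘L f) (fun v w => orth c d ε (df v w)) (ε • β)
      (c * a₁ - ε * d * a₂) (d * a₁ + ε * c * a₂) a₀ := by
  -- With the sign fixed, only the equations for `dω³` and `dω⁶` need `c² + d² = 1`, since their
  -- right sides are quadratic in `(c, d)` after the rotation.
  obtain rfl | rfl : ε = 1 ∨ ε = -1 := by
    rcases mul_eq_zero.1 (show (ε - 1) * (ε + 1) = 0 by linear_combination hε) with h1 | h1
    · exact Or.inl (by linarith)
    · exact Or.inr (by linarith)
  all_goals
    refine ⟨fun v w => ?_, fun v w => ?_, fun v w => ?_, fun v w => ?_, fun v w => ?_,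
      fun v w => ?_⟩
    all_goals
      simp only [orth_0, orth_1, orth_2, orth_3, orth_4, orth_5, cw, lw, H.d0, H.d1, H.d2, H.d3,
        H.d4, H.d5, ContinuousLinearMap.comp_apply, LinearMap.smul_apply, smul_eq_mul]
  · ring
  · ring
  · linear_combination (norm := (simp only [cw]; ring)) (-(cw f 0 1 v w + a₀ * (cw f 0 4 v w - cw f 1 3 v w) - 3 * cw f 3 4 v w
      - (a₁ * cw f 3 5 v w + a₂ * cw f 4 5 v w))) * h
  · ring
  · ring
  · linear_combination (norm := (simp only [cw]; ring)) (-(- 2 * a₀ * cw f 0 1 v w + (a₁ * cw f 0 5 v w + a₂ * cw f 1 5 v w))) * h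
  · ring
  · ring
  · linear_combination (norm := (simp only [cw]; ring)) (cw f 0 1 v w + a₀ * (cw f 0 4 v w - cw f 1 3 v w) - 3 * cw f 3 4 v w
      - (a₁ * cw f 3 5 v w + a₂ * cw f 4 5 v w)) * h
  · ring
  · ring
  · linear_combination (norm := (simp only [cw]; ring)) (- 2 * a₀ * cw f 0 1 v w + (a₁ * cw f 0 5 v w + a₂ * cw f 1 5 v w)) * h

/-- Inserting two of the real basis vectors into `dz¹ ∧ dz² ∧ dz³` leaves a single complex
coordinate of the remaining vector. -/
lemma stdUpsilon_ext {x x' : R6} (h : ∀ y z, stdUpsilon ![x, y, z] = I * stdUpsilon ![x', y, z])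
    (i : Fin 3) : zCoord x i = I * zCoord x' i := by
  have h0 := h (EuclideanSpace.single 1 1) (EuclideanSpace.single 2 1)
  have h1 := h (EuclideanSpace.single 2 1) (EuclideanSpace.single 0 1)
  have h2 := h (EuclideanSpace.single 0 1) (EuclideanSpace.single 1 1)
  simp only [stdUpsilon_eq] at h0 h1 h2
  fin_cases i
  · simpa [zCoord] using h0
  · simpa [zCoord] using h1
  · simpa [zCoord] using h2

/-- Two `O(2)`-coframes at a point differ by an element of `O(2)`. -/
lemma exists_orth {f s : R6 →L[ℝ] R6} (hf : Function.Bijective f) (hs : Function.Bijective s)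
    (hΩ : ∀ v w, stdOmega (f v) (f w) = stdOmega (s v) (s w))
    (hΥ : ∀ u v w, stdUpsilon ![f u, f v, f w] = stdUpsilon ![s u, s v, s w])
    (hk : ∀ v, s v 0 = 0 ∧ s v 1 = 0 → f v 0 = 0 ∧ f v 1 = 0) :
    ∃ c d ε : ℝ, c ^ 2 + d ^ 2 = 1 ∧ ε ^ 2 = 1 ∧ f = orth c d ε ∘L s := by
  -- The frame `b` is dual to `s`; the images `f (b i)` are the columns of `f ∘ s⁻¹`.
  choose b hb using fun i : Fin 6 => hs.2 (EuclideanSpace.single i (1 : ℝ))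
  have expand : ∀ v, f v = ∑ i, s v i • f (b i) := by
    intro v
    have : v = ∑ i, s v i • b i := by
      apply hs.1
      rw [map_sum]
      ext j
      simp [hb, Pi.single_apply]
    conv_lhs => rw [this]
    simp
  -- The 3-form determines the complex structure, so `f ∘ s⁻¹` is complex linear.
  have J : ∀ i j : Fin 6, (∀ y z, stdUpsilon ![EuclideanSpace.single j (1 : ℝ), y, z] =
      I * stdUpsilon ![EuclideanSpace.single i (1 : ℝ), y, z]) →
      ∀ l, zCoord (f (b j)) l = I * zCoord (f (b i)) l := by
    intro i j h l
    apply stdUpsilon_ext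
    intro y z
    obtain ⟨y, rfl⟩ := hf.2 y
    obtain ⟨z, rfl⟩ := hf.2 z
    rw [hΥ, hΥ, hb, hb, h]
  have J03 := J 0 3 (fun y z => by simp [stdUpsilon_eq, zCoord]; ring)
  have J14 := J 1 4 (fun y z => by simp [stdUpsilon_eq, zCoord]; ring)
  have J25 := J 2 5 (fun y z => by simp [stdUpsilon_eq, zCoord]; ring)
  have comps : ∀ x x' : R6, (∀ l, zCoord x l = I * zCoord x' l) →
      x 0 = - x' 3 ∧ x 3 = x' 0 ∧ x 1 = - x' 4 ∧ x 4 = x' 1 ∧ x 2 = - x' 5 ∧ x 5 = x' 2 := by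
    intro x x' h
    have h0 := h 0
    have h1 := h 1
    have h2 := h 2
    simp [zCoord, Complex.ext_iff] at h0 h1 h2
    exact ⟨h0.1, h0.2, h1.1, h1.2, h2.1, h2.2⟩
  obtain ⟨x30, x33, x31, x34, x32, x35⟩ := comps _ _ J03
  obtain ⟨x40, x43, x41, x44, x42, x45⟩ := comps _ _ J14
  obtain ⟨x50, x53, x51, x54, x52, x55⟩ := comps _ _ J25
  -- Vectors tangent to the orbit stay in the kernel of the first two components; with complex
  -- linearity this makes the first two rows of the matrix real.
  obtain ⟨k20, k21⟩ := hk (b 2) (by simp [hb])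
  obtain ⟨k30, k31⟩ := hk (b 3) (by simp [hb])
  obtain ⟨k40, k41⟩ := hk (b 4) (by simp [hb])
  obtain ⟨k50, k51⟩ := hk (b 5) (by simp [hb])
  have Ω25 := hΩ (b 2) (b 5)
  have Ω02 := hΩ (b 0) (b 2)
  have Ω05 := hΩ (b 0) (b 5)
  have Ω12 := hΩ (b 1) (b 2)
  have Ω15 := hΩ (b 1) (b 5)
  have Ω03 := hΩ (b 0) (b 3)
  have Ω04 := hΩ (b 0) (b 4)
  have Ω14 := hΩ (b 1) (b 4)
  have Υ012 := hΥ (b 0) (b 1) (b 2)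
  have y03 : f (b 0) 3 = 0 := by linarith
  have y04 : f (b 0) 4 = 0 := by linarith
  have y13 : f (b 1) 3 = 0 := by linarith
  have y14 : f (b 1) 4 = 0 := by linarith
  have y23 : f (b 2) 3 = 0 := by linarith
  have y24 : f (b 2) 4 = 0 := by linarith
  simp only [stdOmega, hb, x32, x33, x34, x35, x42, x43, x44, x45, x52, x53, x54, x55, k20, k21,
    k30, k31, k40, k41, k50, k51, y03, y04, y13, y14, y23, y24]
    at Ω25 Ω02 Ω05 Ω12 Ω15 Ω03 Ω04 Ω14
  simp at Ω25 Ω02 Ω05 Ω12 Ω15 Ω03 Ω04 Ω14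
  rw [hb, hb, hb] at Υ012
  simp [stdUpsilon_eq, zCoord, k20, k21, y03, y04, y13, y14, y23, y24, Complex.ext_iff] at Υ012
  have z02 : f (b 0) 2 = 0 := by
    linear_combination f (b 2) 5 * Ω02 + f (b 2) 2 * Ω05 - f (b 0) 2 * Ω25
  have z05 : f (b 0) 5 = 0 := by
    linear_combination -f (b 2) 2 * Ω02 + f (b 2) 5 * Ω05 - f (b 0) 5 * Ω25
  have z12 : f (b 1) 2 = 0 := by
    linear_combination f (b 2) 5 * Ω12 + f (b 2) 2 * Ω15 - f (b 1) 2 * Ω25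
  have z15 : f (b 1) 5 = 0 := by
    linear_combination -f (b 2) 2 * Ω12 + f (b 2) 5 * Ω15 - f (b 1) 5 * Ω25
  simp only [z02, z05, z12, z15, mul_zero, add_zero] at Ω03 Ω04 Ω14 Υ012
  obtain ⟨U1, U2⟩ := Υ012
  -- Gram determinant of two orthonormal vectors in the plane.
  have hD : (f (b 0) 0 * f (b 1) 1 - f (b 1) 0 * f (b 0) 1) ^ 2 = 1 := by
    linear_combination (f (b 1) 0 * f (b 1) 0 + f (b 1) 1 * f (b 1) 1) * Ω03 + Ω14 -
      (f (b 0) 0 * f (b 1) 0 + f (b 0) 1 * f (b 1) 1) * Ω04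
  refine ⟨f (b 0) 0, f (b 0) 1, f (b 0) 0 * f (b 1) 1 - f (b 1) 0 * f (b 0) 1,
    by linear_combination Ω03, hD, ?_⟩
  -- The complex determinant is `1`, so the third diagonal entry is the inverse of the determinant
  -- of the 2×2 block, that is, the same sign.
  have w22 : f (b 2) 2 = f (b 0) 0 * f (b 1) 1 - f (b 1) 0 * f (b 0) 1 := by
    linear_combination (f (b 0) 0 * f (b 1) 1 - f (b 1) 0 * f (b 0) 1) * U1 - f (b 2) 2 * hD
  have w25 : f (b 2) 5 = 0 := by
    linear_combination (f (b 0) 0 * f (b 1) 1 - f (b 1) 0 * f (b 0) 1) * U2 - f (b 2) 5 * hD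
  have w10 : f (b 1) 0 = -(f (b 0) 0 * f (b 1) 1 - f (b 1) 0 * f (b 0) 1) * f (b 0) 1 := by
    linear_combination f (b 0) 0 * Ω04 - f (b 1) 0 * Ω03
  have w11 : f (b 1) 1 = (f (b 0) 0 * f (b 1) 1 - f (b 1) 0 * f (b 0) 1) * f (b 0) 0 := by
    linear_combination f (b 0) 1 * Ω04 - f (b 1) 1 * Ω03
  generalize f (b 0) 0 * f (b 1) 1 - f (b 1) 0 * f (b 0) 1 = ε at *
  ext v i
  rw [expand v, Fin.sum_univ_six]
  fin_cases i
  · change (_ : R6) 0 = orth _ _ _ (s v) 0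
    simp [orth_0, k20, k30, k40, k50, w10]
    ring
  · change (_ : R6) 1 = orth _ _ _ (s v) 1
    simp [orth_1, k21, k31, k41, k51, w11]
    ring
  · change (_ : R6) 2 = orth _ _ _ (s v) 2
    simp [orth_2, z02, z12, x32, x42, x52, z05, z15, w22, w25]
    ring
  · change (_ : R6) 3 = orth _ _ _ (s v) 3
    simp [orth_3, y03, y13, y23, x33, x43, x53, w10, k20]
    ring
  · change (_ : R6) 4 = orth _ _ _ (s v) 4
    simp [orth_4, y04, y14, y24, x34, x44, x54, w11, k21]
    ring
  · change (_ : R6) 5 = orth _ _ _ (s v) 5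
    simp [orth_5, z05, z15, x35, x45, x55, z02, z12, w22, w25]
    ring

variable {σ : R6 → R6 →L[ℝ] R6} {y : R6} {U : Set R6} {W : R6 → Submodule ℝ R6}

/-- The torsion at an `O(2)`-coframe obtained by rotating a coframing that satisfies the reduced
structure equations. -/
lemma isAt_orth_comp (hU : IsOpen U) (hσ : ContDiffOn ℝ ∞ σ U)
    (hO : ∀ y ∈ U, IsO2Coframe (omegaOf σ) (upsilonOf σ) W y (σ y)) (hy : y ∈ U)
    {β : R6 →ₗ[ℝ] ℝ} {a₁ a₂ a₀ : ℝ} (H : ReducedEquations (σ y) (dCoframe σ y) β a₁ a₂ a₀)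
    (h : c ^ 2 + d ^ 2 = 1) (hε : ε ^ 2 = 1) :
    (reducedTorsion (c * a₁ - ε * d * a₂) (d * a₁ + ε * c * a₂) a₀).IsAt (omegaOf σ) (upsilonOf σ)
      W y (orth c d ε ∘L σ y) := by
  have hs : ContDiffAt ℝ ∞ σ y := hσ.contDiffAt (hU.mem_nhds hy)
  refine ⟨fun z => orth c d ε ∘L σ z, contDiffAt_const.clm_comp hs, ?_, rfl, ?_⟩
  · filter_upwards [hU.mem_nhds hy] with z hz
    exact (hO z hz).orth_comp h hε
  · refine ⟨connectionForm (orth c d ε ∘L σ y) (ε • β) a₀, ?_⟩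
    have hd : HasFDerivAt (fun z => orth c d ε ∘L σ z)
        ((ContinuousLinearMap.compL ℝ R6 R6 R6 (orth c d ε)) ∘L fderiv ℝ σ y) y :=
      (ContinuousLinearMap.compL ℝ R6 R6 R6 (orth c d ε)).hasFDerivAt.comp y
        (hs.differentiableAt (by simp)).hasFDerivAt
    have he := (H.orth_comp h hε).structureEquations
    rw [hd.fderiv]
    convert he using 3 with v w
    simp [dCoframe]

/-- Any other `O(2)`-coframe is a constant rotation of `σ y`; rotating the whole section by the same
element gives the torsion there, with `(a₁, a₂)` rotated and `a₀` unchanged. -/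
theorem isTypeIIIWithUZero_of_reducedEquations (hU : IsOpen U) (hσ : ContDiffOn ℝ ∞ σ U)
    (hO : ∀ y ∈ U, IsO2Coframe (omegaOf σ) (upsilonOf σ) W y (σ y))
    (H : ∀ y ∈ U, ∃ β a₁ a₂ a₀, ReducedEquations (σ y) (dCoframe σ y) β a₁ a₂ a₀) :
    IsTypeIIIWithUZero U (omegaOf σ) (upsilonOf σ) W := by
  rintro y hy f ⟨⟨hf, hΩ, hΥ⟩, hW⟩
  obtain ⟨⟨hf', hΩ', hΥ'⟩, hW'⟩ := hO y hy
  obtain ⟨β, a₁, a₂, a₀, he⟩ := H y hy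
  obtain ⟨c, d, ε, h, hε, rfl⟩ := exists_orth hf hf'
    (fun v w => (hΩ ![v, w]).symm.trans (hΩ' ![v, w]))
    (fun u v w => by
      have := (hΥ ![u, v, w]).symm.trans (hΥ' ![u, v, w])
      convert this using 2 <;> (funext i; fin_cases i <;> rfl))
    (fun v hv => (hW v).1 ((hW' v).2 hv))
  exact ⟨_, _, isAt_orth_comp hU hσ hO hy he h hε, reducedTorsion_isTypeIII _ _ _,
    reducedInvariants_of _ _ _, rfl⟩

lemma isAt_of_reducedEquations (hU : IsOpen U) (hσ : ContDiffOn ℝ ∞ σ U)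
    (hO : ∀ y ∈ U, IsO2Coframe (omegaOf σ) (upsilonOf σ) W y (σ y)) (hy : y ∈ U)
    {β : R6 →ₗ[ℝ] ℝ} {a₁ a₂ a₀ : ℝ} (H : ReducedEquations (σ y) (dCoframe σ y) β a₁ a₂ a₀) :
    (reducedTorsion a₁ a₂ a₀).IsAt (omegaOf σ) (upsilonOf σ) W y (σ y) := by
  refine ⟨σ, hσ.contDiffAt (hU.mem_nhds hy), ?_, rfl, _, H.structureEquations⟩
  filter_upwards [hU.mem_nhds hy] with z hz using hO z hz

end OrthogonalGroup

section Profile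

/-! ### Profile functions

The coframing below is built from the following functions of `N = X² + Y²`, in which `s` is a real
parameter. -/

variable (s N : ℝ)

/-- `√(1 + 3 N)`. -/
def fu : ℝ := √(1 + 3 * N)

/-- `√(1 + s² N)`. -/
def ft : ℝ := √(1 + s ^ 2 * N)

/-- The tangential length factor of `η`. -/
def fg : ℝ := 1 / (fu N * ft s N)

/-- The coefficient for which `fg + N fk` is the radial length factor of `η`. -/
def fk : ℝ := (s ^ 2 - 3) / (fu N ^ 2 * ft s N * (fu N + ft s N))

/-- The coefficient of the connection form `β` of the orbit space. -/
def fc : ℝ := fu N ^ 2 * fk s N + fg s N * (3 + s ^ 2 * fu N ^ 2 / ft s N ^ 2)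

/-- The coefficient of `ζ` in `a₁ + i a₂`. -/
def fh : ℝ := (s ^ 2 - 3) / ft s N ^ 2

/-- The invariant `a₀`. -/
def fa : ℝ := s * fu N ^ 2 / ft s N ^ 2

/-- The length factor of `ω⁶`. -/
def fq : ℝ := ft s N / fu N

/-- The coefficient of the connection form of `ω⁶`. -/
def fm : ℝ := - s / ft s N ^ 2

variable {N}

lemma one_add_pos (hN : 0 ≤ N) : 0 < 1 + 3 * N := by positivity

lemma one_add_sq_pos (hN : 0 ≤ N) : 0 < 1 + s ^ 2 * N := by positivity

lemma fu_pos (hN : 0 ≤ N) : 0 < fu N := Real.sqrt_pos.2 (one_add_pos hN)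

lemma ft_pos (hN : 0 ≤ N) : 0 < ft s N := Real.sqrt_pos.2 (one_add_sq_pos s hN)

lemma fu_sq (hN : 0 < 1 + 3 * N) : fu N ^ 2 = 1 + 3 * N := Real.sq_sqrt hN.le

lemma ft_sq (hN : 0 < 1 + s ^ 2 * N) : ft s N ^ 2 = 1 + s ^ 2 * N := Real.sq_sqrt hN.le

lemma hasDerivAt_fu (hN : 0 ≤ N) : HasDerivAt fu (3 / (2 * fu N)) N := by
  have h := (((hasDerivAt_id N).const_mul 3).const_add 1).sqrt (one_add_pos hN).ne'
  refine h.congr_deriv ?_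
  simp [fu]

lemma hasDerivAt_ft (hN : 0 ≤ N) : HasDerivAt (ft s) (s ^ 2 / (2 * ft s N)) N := by
  have h := (((hasDerivAt_id N).const_mul (s ^ 2)).const_add 1).sqrt (one_add_sq_pos s hN).ne'
  refine h.congr_deriv ?_
  simp [ft]

/-- `N (s² - 3)` equals `ft² - fu²`, which cancels the factor `fu + ft`; that denominator keeps `fk`
smooth at `N = 0`. Positivity is assumed instead of `0 ≤ N` so that the identity holds on a
neighbourhood of `N = 0`. -/
lemma fg_add_fk' (hu : 0 < 1 + 3 * N) (ht : 0 < 1 + s ^ 2 * N) :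
    fg s N + N * fk s N = 1 / fu N ^ 2 := by
  have hu' : 0 < fu N := Real.sqrt_pos.2 hu
  have ht' : 0 < ft s N := Real.sqrt_pos.2 ht
  have h1 := fu_sq hu
  have h2 := ft_sq s ht
  unfold fg fk
  field_simp
  linear_combination h1 - h2

lemma fg_add_fk (hN : 0 ≤ N) : fg s N + N * fk s N = 1 / fu N ^ 2 :=
  fg_add_fk' s (one_add_pos hN) (one_add_sq_pos s hN)

lemma hasDerivAt_fg (hN : 0 ≤ N) :
    HasDerivAt (fg s) (-(3 / fu N ^ 2 + s ^ 2 / ft s N ^ 2) * fg s N / 2) N := by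
  have hu := fu_pos hN
  have ht := ft_pos s hN
  have h := ((hasDerivAt_fu hN).mul (hasDerivAt_ft s hN)).inv (mul_pos hu ht).ne'
  refine (h.congr_deriv ?_).congr_of_eventuallyEq (Eventually.of_forall fun z => ?_)
  · simp only [Pi.mul_apply, fg]
    field_simp
  · simp [fg, one_div]

lemma differentiableAt_fk (hN : 0 ≤ N) : DifferentiableAt ℝ (fk s) N := by
  have hu := fu_pos hN
  have ht := ft_pos s hN
  have h1 := (hasDerivAt_fu hN).differentiableAt
  have h2 := (hasDerivAt_ft s hN).differentiableAt
  exact (differentiableAt_const _).div (((h1.pow 2).mul h2).mul (h1.add h2)) (by positivity)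

lemma hasDerivAt_fh (hN : 0 ≤ N) : HasDerivAt (fh s) (-(s ^ 2 - 3) * s ^ 2 / ft s N ^ 4) N := by
  have ht := ft_pos s hN
  have h := (((hasDerivAt_ft s hN).pow 2).inv (pow_pos ht 2).ne').const_mul (s ^ 2 - 3)
  refine (h.congr_deriv ?_).congr_of_eventuallyEq (Eventually.of_forall fun z => ?_)
  · simp
    field_simp
    ring
  · simp [fh, div_eq_mul_inv]

lemma hasDerivAt_fm (hN : 0 ≤ N) : HasDerivAt (fm s) (s * s ^ 2 / ft s N ^ 4) N := by
  have ht := ft_pos s hN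
  have h := (((hasDerivAt_ft s hN).pow 2).inv (pow_pos ht 2).ne').const_mul (-s)
  refine (h.congr_deriv ?_).congr_of_eventuallyEq (Eventually.of_forall fun z => ?_)
  · simp
    field_simp
  · simp [fm, div_eq_mul_inv]

/-- `a₀' = - a₀ h / u²`. -/
lemma hasDerivAt_fa (hN : 0 ≤ N) : HasDerivAt (fa s) (-fa s N * fh s N / fu N ^ 2) N := by
  have hu := fu_pos hN
  have ht := ft_pos s hN
  have h1 := fu_sq (one_add_pos hN)
  have h2 := ft_sq s (one_add_sq_pos s hN)
  have h := (((hasDerivAt_fu hN).pow 2).const_mul s).div ((hasDerivAt_ft s hN).pow 2)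
    (pow_pos ht 2).ne'
  refine (h.congr_deriv ?_).congr_of_eventuallyEq (Eventually.of_forall fun z => ?_)
  · simp [fa, fh]
    field_simp
    linear_combination s * 3 * h2 - s * s ^ 2 * h1
  · simp [fa]

/-- `2 q' = q h / u²`. -/
lemma hasDerivAt_fq (hN : 0 ≤ N) : HasDerivAt (fq s) (fq s N * fh s N / fu N ^ 2 / 2) N := by
  have hu := fu_pos hN
  have ht := ft_pos s hN
  have h1 := fu_sq (one_add_pos hN)
  have h2 := ft_sq s (one_add_sq_pos s hN)
  have h := (hasDerivAt_ft s hN).div (hasDerivAt_fu hN) hu.ne'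
  refine (h.congr_deriv ?_).congr_of_eventuallyEq (Eventually.of_forall fun z => ?_)
  · simp [fq, fh]
    field_simp
    linear_combination s ^ 2 * h1 - 3 * h2
  · simp [fq]

/-- This eliminates `fk`, so that differentiating `N fc` requires only the derivative of `fg`. -/
lemma mul_fc' (hu : 0 < 1 + 3 * N) (ht : 0 < 1 + s ^ 2 * N) :
    N * fc s N = 1 - fg s N * (1 - s ^ 2 * N * (1 + 3 * N) / (1 + s ^ 2 * N)) := by
  have hk : N * fk s N = 1 / fu N ^ 2 - fg s N := by linarith [fg_add_fk' s hu ht]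
  have : N * fc s N = fu N ^ 2 * (N * fk s N) +
    N * fg s N * (3 + s ^ 2 * fu N ^ 2 / ft s N ^ 2) := by unfold fc; ring
  rw [this, hk, fu_sq hu, ft_sq s ht]
  field_simp
  ring

/-- The equation for `da`, in the angular direction. -/
lemma fh_angular (hN : 0 ≤ N) :
    fh s N = fh s N * fc s N * N + (fa s N ^ 2 - 3) * fg s N := by
  have hu := one_add_pos hN
  have ht := one_add_sq_pos s hN
  rw [mul_assoc, mul_comm (fc s N), mul_fc' s hu ht]
  unfold fh fa
  rw [fu_sq hu, ft_sq s ht]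
  field_simp
  ring

/-- The equation for `da`, in the radial direction. -/
lemma fh_radial (hN : 0 ≤ N) : 2 * (-(s ^ 2 - 3) * s ^ 2 / ft s N ^ 4) =
    - fh s N * fc s N + (fa s N ^ 2 - 3) * fk s N - fh s N ^ 2 / fu N ^ 2 := by
  have hu := fu_pos hN
  have ht := ft_pos s hN
  have h1 := fu_sq (one_add_pos hN)
  have h2 := ft_sq s (one_add_sq_pos s hN)
  unfold fh fa fc fg fk
  generalize fu N = u at *
  generalize ft s N = t at *
  field_simp
  linear_combination -(s ^ 2 - 3) * t * (u + t) * (s ^ 2 * h1 - 3 * h2)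

/-- Since `d(mτ) = 2(N m' + m) dX∧dY` and `ω¹∧ω² = (g/u²) dX∧dY`, this is the equation `d(mτ) = -2
(a₀/q) ω¹∧ω²` required by `dω⁶`. -/
lemma fm_curvature (hN : 0 ≤ N) : s * s ^ 2 / ft s N ^ 4 * N + fm s N =
    - (fa s N / fq s N) * fg s N / fu N ^ 2 := by
  have hu := fu_pos hN
  have ht := ft_pos s hN
  have h1 := fu_sq (one_add_pos hN)
  have h2 := ft_sq s (one_add_sq_pos s hN)
  unfold fm fa fq fg
  field_simp
  linear_combination -s * h2

/-- By `fg_add_fk` this is `2g' - k = -c (g + N k)`, the radial form of `dη = iβ∧η`; `fc` is defined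
as its solution. -/
lemma fg_torsion (hN : 0 ≤ N) : -(3 / fu N ^ 2 + s ^ 2 / ft s N ^ 2) * fg s N - fk s N =
    - fc s N / fu N ^ 2 := by
  have hu := fu_pos hN
  have ht := ft_pos s hN
  unfold fc
  field_simp
  ring

/-- The curvature of the orbit space is `3 (1 + a₀²)`. -/
lemma exists_hasDerivAt_fc (hN : 0 ≤ N) : ∃ c' : ℝ, HasDerivAt (fc s) c' N ∧
    2 * (c' * N + fc s N) = 3 * (1 + fa s N ^ 2) * fg s N / fu N ^ 2 := by
  have hu := one_add_pos hN
  have ht := one_add_sq_pos s hN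
  have hd : DifferentiableAt ℝ (fc s) N := by
    have h1 := (hasDerivAt_fu hN).differentiableAt
    have h2 := (hasDerivAt_ft s hN).differentiableAt
    exact ((h1.pow 2).mul (differentiableAt_fk s hN)).add
      ((hasDerivAt_fg s hN).differentiableAt.mul ((differentiableAt_const _).add
        (((differentiableAt_const _).mul (h1.pow 2)).div (h2.pow 2) (pow_pos (ft_pos s hN) 2).ne')))
  refine ⟨_, hd.hasDerivAt, ?_⟩
  -- `d(cτ) = 2 (N c)' dX∧dY`, so only the product `N c` has to be differentiated, in its closed
  -- form.
  have e : (fun z => z * fc s z) =ᶠ[𝓝 N]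
      fun z => 1 - fg s z * (1 - s ^ 2 * z * (1 + 3 * z) / (1 + s ^ 2 * z)) := by
    filter_upwards [(isOpen_lt (by fun_prop : Continuous fun _ : ℝ => (0 : ℝ))
      (by fun_prop : Continuous fun z : ℝ => 1 + 3 * z)).mem_nhds hu,
      (isOpen_lt (by fun_prop : Continuous fun _ : ℝ => (0 : ℝ))
      (by fun_prop : Continuous fun z : ℝ => 1 + s ^ 2 * z)).mem_nhds ht] with z h1 h2
    exact mul_fc' s h1 h2
  have hL := (hasDerivAt_id N).mul hd.hasDerivAt
  have hi := hasDerivAt_id N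
  have hn := ((hi.const_mul (s ^ 2)).mul ((hi.const_mul 3).const_add 1)).div
    ((hi.const_mul (s ^ 2)).const_add 1) ht.ne'
  have hR := ((hasDerivAt_fg s hN).mul (hn.const_sub 1)).const_sub 1
  have hu1 := hL.unique (hR.congr_of_eventuallyEq e)
  simp only [Pi.mul_apply, id_eq, Pi.div_apply] at hu1
  have : 2 * (deriv (fc s) N * N + fc s N) = 2 * (1 * fc s N + N * deriv (fc s) N) := by ring
  rw [this, hu1]
  unfold fa
  rw [fu_sq hu, ft_sq s ht]
  generalize fg s N = g
  field_simp
  ring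

end Profile

/-! ### Exterior derivatives of 1-forms and the reduction to the orbit space -/

section OneForms

/-- The wedge product of two 1-forms at a point, evaluated on `v, w`. -/
def wd (a b : R6 → ℝ) (v w : R6) : ℝ := a v * b w - a w * b v

/-- The 1-form `φ` is differentiable at `y`, with exterior derivative `B`. -/
def HasExtD (φ : R6 → R6 → ℝ) (B : R6 → R6 → ℝ) (y : R6) : Prop :=
  ∃ D : R6 → R6 →L[ℝ] ℝ, (∀ w, HasFDerivAt (fun z => φ z w) (D w) y) ∧
    ∀ v w, D w v - D v w = B v w

variable {φ ψ : R6 → R6 → ℝ} {B C : R6 → R6 → ℝ} {y : R6} {c : R6 → ℝ} {c' : R6 →L[ℝ] ℝ}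

lemma HasExtD.congr (h : HasExtD φ B y) (hBC : ∀ v w, B v w = C v w) : HasExtD φ C y := by
  obtain ⟨D, h1, h2⟩ := h
  exact ⟨D, h1, fun v w => (h2 v w).trans (hBC v w)⟩

lemma HasExtD.add (h : HasExtD φ B y) (h' : HasExtD ψ C y) :
    HasExtD (fun z w => φ z w + ψ z w) (fun v w => B v w + C v w) y := by
  obtain ⟨D, h1, h2⟩ := h
  obtain ⟨D', h1', h2'⟩ := h'
  refine ⟨fun w => D w + D' w, fun w => (h1 w).add (h1' w), fun v w => ?_⟩
  simp only [add_apply]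
  linear_combination h2 v w + h2' v w

lemma HasExtD.smul (h : HasExtD φ B y) (hc : HasFDerivAt c c' y) :
    HasExtD (fun z w => c z * φ z w) (fun v w => wd c' (φ y) v w + c y * B v w) y := by
  obtain ⟨D, h1, h2⟩ := h
  refine ⟨fun w => c y • D w + φ y w • c', fun w => hc.mul (h1 w), fun v w => ?_⟩
  simp only [add_apply, smul_apply, smul_eq_mul, wd]
  linear_combination c y * h2 v w

lemma HasExtD.const_smul (h : HasExtD φ B y) (k : ℝ) :
    HasExtD (fun z w => k * φ z w) (fun v w => k * B v w) y :=
  (h.smul (hasFDerivAt_const k y)).congr fun v w => by simp [wd]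

lemma hasExtD_const (φ : R6 → ℝ) : HasExtD (fun _ w => φ w) (fun _ _ => 0) y :=
  ⟨fun _ => 0, fun _ => hasFDerivAt_const _ _, fun _ _ => by simp⟩

/-- Given the structure equations of the base forms `e₀, e₁, β`, of a Maurer-Cartan coframe
`p₁, p₂, p₃` of `SU(2)` and of `e₅`, and the differentials of the invariants, the remaining forms
satisfy the reduced structure equations. -/
lemma reducedEquations_of_base {σ : R6 → R6 →L[ℝ] R6} (hσ : DifferentiableAt ℝ σ y)
    {e₀ e₁ e₅ β p₁ p₂ p₃ : R6 → R6 → ℝ} {a₁ a₂ a₀ : R6 → ℝ} {b : R6 →ₗ[ℝ] ℝ}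
    {da₁ da₂ da₀ : R6 →L[ℝ] ℝ}
    (s0 : ∀ z v, σ z v 0 = e₀ z v) (s1 : ∀ z v, σ z v 1 = e₁ z v)
    (s2 : ∀ z v, σ z v 2 = 2 / 3 * p₃ z v + 1 / 3 * β z v + 1 / 3 * (a₀ z * e₅ z v))
    (s3 : ∀ z v, σ z v 3 = 2 / 3 * p₁ z v + 1 / 3 * (a₀ z * e₀ z v) + 1 / 3 * (a₂ z * e₅ z v))
    (s4 : ∀ z v, σ z v 4 = 2 / 3 * p₂ z v + 1 / 3 * (a₀ z * e₁ z v) + -1 / 3 * (a₁ z * e₅ z v))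
    (s5 : ∀ z v, σ z v 5 = e₅ z v) (hb : ∀ v, b v = β y v)
    (h0 : HasExtD e₀ (fun v w => - wd (β y) (e₁ y) v w) y)
    (h1 : HasExtD e₁ (fun v w => wd (β y) (e₀ y) v w) y)
    (hβ : HasExtD β (fun v w => 3 * (1 + a₀ y ^ 2) * wd (e₀ y) (e₁ y) v w) y)
    (h5 : HasExtD e₅ (fun v w => - 2 * a₀ y * wd (e₀ y) (e₁ y) v w
      + (a₁ y * wd (e₀ y) (e₅ y) v w + a₂ y * wd (e₁ y) (e₅ y) v w)) y)
    (hp1 : HasExtD p₁ (fun v w => - 2 * wd (p₂ y) (p₃ y) v w) y)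
    (hp2 : HasExtD p₂ (fun v w => - 2 * wd (p₃ y) (p₁ y) v w) y)
    (hp3 : HasExtD p₃ (fun v w => - 2 * wd (p₁ y) (p₂ y) v w) y)
    (ha1 : HasFDerivAt a₁ da₁ y) (ha2 : HasFDerivAt a₂ da₂ y) (ha0 : HasFDerivAt a₀ da₀ y)
    (hda1 : ∀ v, da₁ v = - a₂ y * β y v + (a₀ y ^ 2 - 3 - a₁ y ^ 2) * e₀ y v
      - a₁ y * a₂ y * e₁ y v)
    (hda2 : ∀ v, da₂ v = a₁ y * β y v + (a₀ y ^ 2 - 3 - a₂ y ^ 2) * e₁ y v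
      - a₁ y * a₂ y * e₀ y v)
    (hda0 : ∀ v, da₀ v = - 2 * a₀ y * (a₁ y * e₀ y v + a₂ y * e₁ y v)) :
    ReducedEquations (σ y) (dCoframe σ y) b (a₁ y) (a₂ y) (a₀ y) := by
  -- Uniqueness of derivatives identifies component `i` of `dCoframe` with any exterior derivative
  -- found for the `i`-th component form.
  have key : ∀ (i : Fin 6) (φ B : R6 → R6 → ℝ), (∀ z v, σ z v i = φ z v) → HasExtD φ B y →
      ∀ v w, dCoframe σ y v w i = B v w := by
    rintro i φ B hi ⟨D, hD, hB⟩ v w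
    have hc : ∀ w, D w = (EuclideanSpace.proj i : R6 →L[ℝ] ℝ) ∘L ((fderiv ℝ σ y).flip w) := by
      intro w
      refine (hD w).unique ?_
      have h1 : HasFDerivAt (fun z => σ z w) ((fderiv ℝ σ y).flip w) y := by
        simpa using hσ.hasFDerivAt.clm_apply (hasFDerivAt_const w y)
      have h2 := (EuclideanSpace.proj i : R6 →L[ℝ] ℝ).hasFDerivAt.comp y h1
      refine h2.congr_of_eventuallyEq (Eventually.of_forall fun z => ?_)
      exact (hi z w).symm
    rw [← hB, hc, hc]
    simp [dCoframe]
  have k2 := key 2 _ _ s2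
    (((hp3.const_smul (2 / 3)).add (hβ.const_smul (1 / 3))).add ((h5.smul ha0).const_smul (1 / 3)))
  have k3 := key 3 _ _ s3 (((hp1.const_smul (2 / 3)).add ((h0.smul ha0).const_smul (1 / 3))).add
    ((h5.smul ha2).const_smul (1 / 3)))
  have k4 := key 4 _ _ s4 (((hp2.const_smul (2 / 3)).add ((h1.smul ha0).const_smul (1 / 3))).add
    ((h5.smul ha1).const_smul (-1 / 3)))
  refine ⟨fun v w => ?_, fun v w => ?_, fun v w => ?_, fun v w => ?_, fun v w => ?_, fun v w => ?_⟩
  · rw [key 0 _ _ s0 h0]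
    simp only [wd, lw, s1, hb]
  · rw [key 1 _ _ s1 h1]
    simp only [wd, lw, s0, hb]
  · rw [k2]
    simp only [wd, cw, s0, s1, s3, s4, s5, hda0]
    ring
  · rw [k3]
    simp only [wd, cw, lw, s1, s2, s4, s5, hda0, hda2, hb]
    ring
  · rw [k4]
    simp only [wd, cw, lw, s0, s2, s3, s5, hda0, hda1, hb]
    ring
  · rw [key 5 _ _ s5 h5]
    simp only [wd, cw, s0, s1, s5]

end OneForms

/-! ### Invariant forms on `ℍˣ × ℝ²` -/

section Coframing

open Quaternion

/-- The quaternion with components the first four coordinates. -/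
def quat : R6 →L[ℝ] ℍ[ℝ] :=
  LinearMap.toContinuousLinearMap
    { toFun := fun v => ⟨v 0, v 1, v 2, v 3⟩
      map_add' := fun v w => by ext <;> rfl
      map_smul' := fun a v => by ext <;> rfl }

/-- The components of a quaternion. -/
def quatComp (i : Fin 4) : ℍ[ℝ] →L[ℝ] ℝ :=
  LinearMap.toContinuousLinearMap
    { toFun := fun p => ![p.re, p.imI, p.imJ, p.imK] i
      map_add' := fun v w => by fin_cases i <;> simp
      map_smul' := fun a v => by fin_cases i <;> simp }

lemma quatComp_0 (p : ℍ[ℝ]) : quatComp 0 p = p.re := rfl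
lemma quatComp_1 (p : ℍ[ℝ]) : quatComp 1 p = p.imI := rfl
lemma quatComp_2 (p : ℍ[ℝ]) : quatComp 2 p = p.imJ := rfl
lemma quatComp_3 (p : ℍ[ℝ]) : quatComp 3 p = p.imK := rfl

/-- The Maurer-Cartan form `g⁻¹ dg` of the group `ℍˣ`. -/
def mcForm (o z w : R6) : ℍ[ℝ] := (quat (z + o))⁻¹ * quat w

variable (s : ℝ) (o : R6)

/-- The coordinate `X` of the orbit space. -/
def cX (z : R6) : ℝ := z 4 + o 4

/-- The coordinate `Y` of the orbit space. -/
def cY (z : R6) : ℝ := z 5 + o 5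

/-- `N = X² + Y²`. -/
def cN (z : R6) : ℝ := cX o z ^ 2 + cY o z ^ 2

/-- `X dX + Y dY`. -/
def nuForm (z w : R6) : ℝ := cX o z * w 4 + cY o z * w 5

/-- `X dY - Y dX`. -/
def tauForm (z w : R6) : ℝ := cX o z * w 5 + -1 * (cY o z * w 4)

/-- `ω¹`. -/
def form₀ (z w : R6) : ℝ := fg s (cN o z) * w 4 + fk s (cN o z) * (cX o z * nuForm o z w)

/-- `ω²`. -/
def form₁ (z w : R6) : ℝ := fg s (cN o z) * w 5 + fk s (cN o z) * (cY o z * nuForm o z w)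

/-- The connection form of the orbit space. -/
def formβ (z w : R6) : ℝ := fc s (cN o z) * tauForm o z w

/-- `ω⁶`. -/
def form₅ (z w : R6) : ℝ :=
  fq s (cN o z) * (quatComp 0 (mcForm o z w) + fm s (cN o z) * tauForm o z w)

/-- The invariants `a₁, a₂, a₀` of the coframing. -/
def inv₁ (z : R6) : ℝ := fh s (cN o z) * cX o z

/-- See `inv₁`. -/
def inv₂ (z : R6) : ℝ := fh s (cN o z) * cY o z

/-- See `inv₁`. -/
def inv₀ (z : R6) : ℝ := fa s (cN o z)

variable {s o} {y : R6}

lemma cN_nonneg : 0 ≤ cN o y := by unfold cN; positivity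

lemma hasFDerivAt_cX : HasFDerivAt (cX o) (EuclideanSpace.proj 4 : R6 →L[ℝ] ℝ) y :=
  (EuclideanSpace.proj 4 : R6 →L[ℝ] ℝ).hasFDerivAt.add_const _

lemma hasFDerivAt_cY : HasFDerivAt (cY o) (EuclideanSpace.proj 5 : R6 →L[ℝ] ℝ) y :=
  (EuclideanSpace.proj 5 : R6 →L[ℝ] ℝ).hasFDerivAt.add_const _

/-- The differential of `N`. -/
def dN (o y : R6) : R6 →L[ℝ] ℝ :=
  (2 * cX o y) • (EuclideanSpace.proj 4 : R6 →L[ℝ] ℝ) +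
    (2 * cY o y) • (EuclideanSpace.proj 5 : R6 →L[ℝ] ℝ)

lemma dN_apply (v : R6) : dN o y v = 2 * nuForm o y v := by
  simp [dN, nuForm]
  ring

lemma hasFDerivAt_cN : HasFDerivAt (cN o) (dN o y) y := by
  have h := ((hasFDerivAt_cX (o := o) (y := y)).pow 2).add ((hasFDerivAt_cY (o := o) (y := y)).pow 2)
  refine h.congr_fderiv ?_
  simp [dN]

lemma hasFDerivAt_comp_cN {F : ℝ → ℝ} {F' : ℝ} (h : HasDerivAt F F' (cN o y)) :
    HasFDerivAt (fun z => F (cN o z)) (F' • dN o y) y :=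
  h.comp_hasFDerivAt y hasFDerivAt_cN

lemma hasExtD_nuForm : HasExtD (nuForm o) (fun _ _ => 0) y := by
  refine (((hasExtD_const fun w => w 4).smul hasFDerivAt_cX).add
    ((hasExtD_const fun w => w 5).smul hasFDerivAt_cY)).congr fun v w => ?_
  simp [wd]
  ring

lemma hasExtD_tauForm :
    HasExtD (tauForm o) (fun v w => 2 * wd (fun x => x 4) (fun x => x 5) v w) y := by
  refine (((hasExtD_const fun w => w 5).smul hasFDerivAt_cX).add
    (((hasExtD_const fun w => w 4).smul hasFDerivAt_cY).const_smul (-1))).congr fun v w => ?_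
  simp [wd]
  ring

/-- Both sides are multiples of `Y dX∧dY`; the coefficients agree by `2g' - k = -c (g + N k)`. -/
lemma hasExtD_form₀ :
    HasExtD (form₀ s o) (fun v w => - wd (formβ s o y) (form₁ s o y) v w) y := by
  have hN := cN_nonneg (o := o) (y := y)
  have hk := hasFDerivAt_comp_cN (differentiableAt_fk s hN).hasDerivAt
  have hg := hasFDerivAt_comp_cN (hasDerivAt_fg s hN)
  refine (((hasExtD_const fun w => w 4).smul hg).add
    ((hasExtD_nuForm.smul hasFDerivAt_cX).smul hk)).congr fun v w => ?_
  have ht := fg_torsion s hN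
  have hs := fg_add_fk s hN
  have hN' : cN o y = cX o y ^ 2 + cY o y ^ 2 := rfl
  have hc : fc s (cN o y) * (fg s (cN o y) + cN o y * fk s (cN o y)) =
    (3 / fu (cN o y) ^ 2 + s ^ 2 / ft s (cN o y) ^ 2) * fg s (cN o y) + fk s (cN o y) := by
    rw [hs]
    linear_combination ht
  simp only [wd, formβ, form₁, tauForm, nuForm, smul_apply, dN_apply, smul_eq_mul, PiLp.proj_apply]
  linear_combination -(cY o y * (v 4 * w 5 - w 4 * v 5)) * hc +
    cY o y * (v 4 * w 5 - w 4 * v 5) * fc s (cN o y) * fk s (cN o y) * hN'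

lemma hasExtD_form₁ :
    HasExtD (form₁ s o) (fun v w => wd (formβ s o y) (form₀ s o y) v w) y := by
  have hN := cN_nonneg (o := o) (y := y)
  have hk := hasFDerivAt_comp_cN (differentiableAt_fk s hN).hasDerivAt
  have hg := hasFDerivAt_comp_cN (hasDerivAt_fg s hN)
  refine (((hasExtD_const fun w => w 5).smul hg).add
    ((hasExtD_nuForm.smul hasFDerivAt_cY).smul hk)).congr fun v w => ?_
  have ht := fg_torsion s hN
  have hs := fg_add_fk s hN
  have hN' : cN o y = cX o y ^ 2 + cY o y ^ 2 := rfl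
  have hc : fc s (cN o y) * (fg s (cN o y) + cN o y * fk s (cN o y)) =
    (3 / fu (cN o y) ^ 2 + s ^ 2 / ft s (cN o y) ^ 2) * fg s (cN o y) + fk s (cN o y) := by
    rw [hs]
    linear_combination ht
  simp only [wd, formβ, form₀, tauForm, nuForm, smul_apply, dN_apply, smul_eq_mul, PiLp.proj_apply]
  linear_combination (cX o y * (v 4 * w 5 - w 4 * v 5)) * hc -
    cX o y * (v 4 * w 5 - w 4 * v 5) * fc s (cN o y) * fk s (cN o y) * hN'

/-- The area form of the orbit space. -/
lemma wd_form₀_form₁ (v w : R6) : wd (form₀ s o y) (form₁ s o y) v w =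
    fg s (cN o y) / fu (cN o y) ^ 2 * (v 4 * w 5 - w 4 * v 5) := by
  have hs := fg_add_fk s (cN_nonneg (o := o) (y := y))
  have hN' : cN o y = cX o y ^ 2 + cY o y ^ 2 := rfl
  simp only [wd, form₀, form₁, nuForm]
  linear_combination fg s (cN o y) * (v 4 * w 5 - w 4 * v 5) * hs -
    fg s (cN o y) * fk s (cN o y) * (v 4 * w 5 - w 4 * v 5) * hN'

lemma hasExtD_formβ : HasExtD (formβ s o)
    (fun v w => 3 * (1 + inv₀ s o y ^ 2) * wd (form₀ s o y) (form₁ s o y) v w) y := by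
  obtain ⟨c', hc, hc'⟩ := exists_hasDerivAt_fc s (cN_nonneg (o := o) (y := y))
  refine (hasExtD_tauForm.smul (hasFDerivAt_comp_cN hc)).congr fun v w => ?_
  have hN' : cN o y = cX o y ^ 2 + cY o y ^ 2 := rfl
  rw [wd_form₀_form₁]
  simp only [wd, tauForm, nuForm, smul_apply, dN_apply, smul_eq_mul, inv₀]
  linear_combination (v 4 * w 5 - w 4 * v 5) * hc' - 2 * c' * (v 4 * w 5 - w 4 * v 5) * hN'

/-- `a₁ ω¹ + a₂ ω²` is a multiple of `X dX + Y dY`. -/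
lemma inv_form (v : R6) : inv₁ s o y * form₀ s o y v + inv₂ s o y * form₁ s o y v =
    fh s (cN o y) / fu (cN o y) ^ 2 * nuForm o y v := by
  have hs := fg_add_fk s (cN_nonneg (o := o) (y := y))
  have hN' : cN o y = cX o y ^ 2 + cY o y ^ 2 := rfl
  simp only [form₀, form₁, nuForm, inv₁, inv₂]
  linear_combination fh s (cN o y) * (cX o y * v 4 + cY o y * v 5) * hs -
    fh s (cN o y) * fk s (cN o y) * (cX o y * v 4 + cY o y * v 5) * hN'

lemma hasFDerivAt_inv₀ : ∃ L : R6 →L[ℝ] ℝ, HasFDerivAt (inv₀ s o) L y ∧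
    ∀ v, L v = -2 * inv₀ s o y * (inv₁ s o y * form₀ s o y v + inv₂ s o y * form₁ s o y v) := by
  refine ⟨_, hasFDerivAt_comp_cN (hasDerivAt_fa s cN_nonneg), fun v => ?_⟩
  rw [inv_form]
  simp only [smul_apply, dN_apply, smul_eq_mul, inv₀]
  ring

/-- From `-Yτ = N dX - Xν`, both sides are combinations of `dX` and `Xν`. The coefficients are
compared by `fh_angular` and `fh_radial` respectively. -/
lemma hasFDerivAt_inv₁ : ∃ L : R6 →L[ℝ] ℝ, HasFDerivAt (inv₁ s o) L y ∧
    ∀ v, L v = - inv₂ s o y * formβ s o y v + (inv₀ s o y ^ 2 - 3 - inv₁ s o y ^ 2) * form₀ s o y v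
      - inv₁ s o y * inv₂ s o y * form₁ s o y v := by
  have hN := cN_nonneg (o := o) (y := y)
  refine ⟨_, (hasFDerivAt_comp_cN (hasDerivAt_fh s hN)).mul hasFDerivAt_cX, fun v => ?_⟩
  have hi := inv_form (s := s) (o := o) (y := y) v
  have h1 := fh_angular s hN
  have h2 := fh_radial s hN
  have hN' : cN o y = cX o y ^ 2 + cY o y ^ 2 := rfl
  have e : (inv₀ s o y ^ 2 - 3 - inv₁ s o y ^ 2) * form₀ s o y v
      - inv₁ s o y * inv₂ s o y * form₁ s o y v = (inv₀ s o y ^ 2 - 3) * form₀ s o y v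
      - inv₁ s o y * (fh s (cN o y) / fu (cN o y) ^ 2 * nuForm o y v) := by
    rw [← hi]
    ring
  rw [add_sub_assoc, e]
  simp only [add_apply, smul_apply, dN_apply, smul_eq_mul, PiLp.proj_apply, inv₀, inv₁, inv₂, form₀,
    formβ, tauForm, nuForm]
  linear_combination v 4 * h1 + cX o y * (cX o y * v 4 + cY o y * v 5) * h2 +
    fh s (cN o y) * fc s (cN o y) * v 4 * hN'

lemma hasFDerivAt_inv₂ : ∃ L : R6 →L[ℝ] ℝ, HasFDerivAt (inv₂ s o) L y ∧
    ∀ v, L v = inv₁ s o y * formβ s o y v + (inv₀ s o y ^ 2 - 3 - inv₂ s o y ^ 2) * form₁ s o y v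
      - inv₁ s o y * inv₂ s o y * form₀ s o y v := by
  have hN := cN_nonneg (o := o) (y := y)
  refine ⟨_, (hasFDerivAt_comp_cN (hasDerivAt_fh s hN)).mul hasFDerivAt_cY, fun v => ?_⟩
  have hi := inv_form (s := s) (o := o) (y := y) v
  have h1 := fh_angular s hN
  have h2 := fh_radial s hN
  have hN' : cN o y = cX o y ^ 2 + cY o y ^ 2 := rfl
  have e : (inv₀ s o y ^ 2 - 3 - inv₂ s o y ^ 2) * form₁ s o y v
      - inv₁ s o y * inv₂ s o y * form₀ s o y v = (inv₀ s o y ^ 2 - 3) * form₁ s o y v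
      - inv₂ s o y * (fh s (cN o y) / fu (cN o y) ^ 2 * nuForm o y v) := by
    rw [← hi]
    ring
  rw [add_sub_assoc, e]
  simp only [add_apply, smul_apply, dN_apply, smul_eq_mul, PiLp.proj_apply, inv₀, inv₁, inv₂, form₁,
    formβ, tauForm, nuForm]
  linear_combination v 5 * h1 + cY o y * (cX o y * v 4 + cY o y * v 5) * h2 +
    fh s (cN o y) * fc s (cN o y) * v 5 * hN'

/-- The Maurer-Cartan equation. -/
lemma hasExtD_mcForm (hy : quat (y + o) ≠ 0) (i : Fin 4) :
    HasExtD (fun z w => quatComp i (mcForm o z w))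
      (fun v w => - quatComp i (mcForm o y v * mcForm o y w - mcForm o y w * mcForm o y v)) y := by
  have h1 : HasFDerivAt (fun z => quat (z + o)) quat y :=
    quat.hasFDerivAt.comp y ((hasFDerivAt_id y).add_const o)
  have h2 := (hasFDerivAt_inv' (𝕜 := ℝ) hy).comp y h1
  refine ⟨fun w => quatComp i ∘L ((ContinuousLinearMap.mul ℝ ℍ[ℝ]).flip (quat w)) ∘L
    (-ContinuousLinearMap.mulLeftRight ℝ ℍ[ℝ] (quat (y + o))⁻¹ (quat (y + o))⁻¹) ∘L quat,
    fun w => ?_, fun v w => ?_⟩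
  · exact (quatComp i).hasFDerivAt.comp y
      (((ContinuousLinearMap.mul ℝ ℍ[ℝ]).flip (quat w)).hasFDerivAt.comp y h2)
  · have e : ∀ a b c d : ℍ[ℝ], quatComp i a - quatComp i b = -quatComp i (c - d) ↔
        quatComp i (a - b) = quatComp i (d - c) := by
      intro a b c d
      rw [← map_neg, map_sub, neg_sub]
    refine (e _ _ _ _).2 (congrArg _ ?_)
    set a := (quat (y + o))⁻¹
    change -(a * quat v * a) * quat w - -(a * quat w * a) * quat v =
      a * quat w * (a * quat v) - a * quat v * (a * quat w)
    noncomm_ring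

/-- The real part of `g⁻¹dg` is closed because commutators are imaginary. The derivative of the
factor `q` produces `(a₁ω¹ + a₂ω²)∧ω⁶`, and `d(mτ)` produces the area term. -/
lemma hasExtD_form₅ (hy : quat (y + o) ≠ 0) : HasExtD (form₅ s o)
    (fun v w => -2 * inv₀ s o y * wd (form₀ s o y) (form₁ s o y) v w +
      (inv₁ s o y * wd (form₀ s o y) (form₅ s o y) v w +
        inv₂ s o y * wd (form₁ s o y) (form₅ s o y) v w)) y := by
  have hN := cN_nonneg (o := o) (y := y)
  have h0 : HasExtD (fun z w => quatComp 0 (mcForm o z w)) (fun _ _ => 0) y := by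
    refine (hasExtD_mcForm hy 0).congr fun v w => ?_
    simp [quatComp_0]
    ring
  refine ((h0.add (hasExtD_tauForm.smul (hasFDerivAt_comp_cN (hasDerivAt_fm s hN)))).smul
    (hasFDerivAt_comp_cN (hasDerivAt_fq s hN))).congr fun v w => ?_
  have e : inv₁ s o y * wd (form₀ s o y) (form₅ s o y) v w +
        inv₂ s o y * wd (form₁ s o y) (form₅ s o y) v w =
      wd (fun v => fh s (cN o y) / fu (cN o y) ^ 2 * nuForm o y v) (form₅ s o y) v w := by
    simp only [wd]
    rw [← inv_form, ← inv_form]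
    ring
  rw [e, wd_form₀_form₁]
  have hc := fm_curvature s hN
  have hq : fq s (cN o y) ≠ 0 := (div_pos (ft_pos s hN) (fu_pos hN)).ne'
  have hc' : fq s (cN o y) * (s * s ^ 2 / ft s (cN o y) ^ 4 * cN o y + fm s (cN o y)) =
    - inv₀ s o y * fg s (cN o y) / fu (cN o y) ^ 2 := by
    rw [hc, inv₀]
    field_simp
  have hN' : cN o y = cX o y ^ 2 + cY o y ^ 2 := rfl
  simp only [wd, form₅, tauForm, nuForm, smul_apply, dN_apply, smul_eq_mul]
  linear_combination 2 * (v 4 * w 5 - w 4 * v 5) * hc' -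
    2 * (v 4 * w 5 - w 4 * v 5) * fq s (cN o y) * (s * s ^ 2 / ft s (cN o y) ^ 4) * hN'

end Coframing

/-! ### The explicit coframing and its initial values -/

section Coframe

open Quaternion

variable (s : ℝ) (o : R6)

/-- The components of the coframing. -/
def coframeVec (z w : R6) : R6 :=
  !₂[form₀ s o z w, form₁ s o z w,
    2 / 3 * quatComp 3 (mcForm o z w) + 1 / 3 * formβ s o z w + 1 / 3 * (inv₀ s o z * form₅ s o z w),
    2 / 3 * quatComp 1 (mcForm o z w) + 1 / 3 * (inv₀ s o z * form₀ s o z w)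
      + 1 / 3 * (inv₂ s o z * form₅ s o z w),
    2 / 3 * quatComp 2 (mcForm o z w) + 1 / 3 * (inv₀ s o z * form₁ s o z w)
      + -1 / 3 * (inv₁ s o z * form₅ s o z w),
    form₅ s o z w]

lemma mcForm_add (z v w : R6) : mcForm o z (v + w) = mcForm o z v + mcForm o z w := by
  simp [mcForm, mul_add]

lemma mcForm_smul (z v : R6) (a : ℝ) : mcForm o z (a • v) = a • mcForm o z v := by
  simp [mcForm]

/-- The coframing of the explicit nearly-Kähler structures. -/
def coframe (z : R6) : R6 →L[ℝ] R6 :=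
  LinearMap.toContinuousLinearMap
    { toFun := coframeVec s o z
      map_add' := fun v w => by
        ext i
        fin_cases i <;>
          simp [coframeVec, form₀, form₁, formβ, form₅, tauForm, nuForm, mcForm_add] <;> ring
      map_smul' := fun a v => by
        ext i
        fin_cases i <;>
          simp [coframeVec, form₀, form₁, formβ, form₅, tauForm, nuForm, mcForm_smul] <;> ring }

/-- The connection form of the orbit space at a point, as a linear map. -/
def linβ (z : R6) : R6 →ₗ[ℝ] ℝ where
  toFun := formβ s o z
  map_add' v w := by simp [formβ, tauForm]; ring
  map_smul' a v := by simp [formβ, tauForm]; ring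

/-- The domain of the structure: the orbit space is `ℝ²` and the orbits are copies of `ℍˣ`. -/
def domain : Set R6 := {z | quat (z + o) ≠ 0}

lemma isOpen_domain : IsOpen (domain o) :=
  isOpen_ne_fun (quat.continuous.comp (continuous_id.add continuous_const)) continuous_const

lemma contDiff_cX : ContDiff ℝ ∞ (cX o) := by unfold cX; fun_prop

lemma contDiff_cY : ContDiff ℝ ∞ (cY o) := by unfold cY; fun_prop

lemma contDiff_cN : ContDiff ℝ ∞ (cN o) := ((contDiff_cX o).pow 2).add ((contDiff_cY o).pow 2)

lemma contDiff_fu : ContDiff ℝ ∞ fun z => fu (cN o z) :=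
  (contDiff_const.add (contDiff_const.mul (contDiff_cN o))).sqrt
    fun _ => (one_add_pos cN_nonneg).ne'

lemma contDiff_ft : ContDiff ℝ ∞ fun z => ft s (cN o z) :=
  (contDiff_const.add (contDiff_const.mul (contDiff_cN o))).sqrt
    fun _ => (one_add_sq_pos s cN_nonneg).ne'

lemma fu_ne (z : R6) : fu (cN o z) ≠ 0 := (fu_pos cN_nonneg).ne'

lemma ft_ne (z : R6) : ft s (cN o z) ≠ 0 := (ft_pos s cN_nonneg).ne'

lemma contDiff_fg : ContDiff ℝ ∞ fun z => fg s (cN o z) :=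
  contDiff_const.div ((contDiff_fu o).mul (contDiff_ft s o))
    fun z => mul_ne_zero (fu_ne o z) (ft_ne s o z)

lemma contDiff_fk : ContDiff ℝ ∞ fun z => fk s (cN o z) :=
  contDiff_const.div ((((contDiff_fu o).pow 2).mul (contDiff_ft s o)).mul
    ((contDiff_fu o).add (contDiff_ft s o))) fun z =>
    mul_ne_zero (mul_ne_zero (pow_ne_zero 2 (fu_ne o z)) (ft_ne s o z))
      (add_pos (fu_pos cN_nonneg) (ft_pos s cN_nonneg)).ne'

lemma contDiff_fc : ContDiff ℝ ∞ fun z => fc s (cN o z) :=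
  (((contDiff_fu o).pow 2).mul (contDiff_fk s o)).add ((contDiff_fg s o).mul (contDiff_const.add
    ((contDiff_const.mul ((contDiff_fu o).pow 2)).div ((contDiff_ft s o).pow 2)
      fun z => pow_ne_zero 2 (ft_ne s o z))))

lemma contDiff_fh : ContDiff ℝ ∞ fun z => fh s (cN o z) :=
  contDiff_const.div ((contDiff_ft s o).pow 2) fun z => pow_ne_zero 2 (ft_ne s o z)

lemma contDiff_inv₀ : ContDiff ℝ ∞ (inv₀ s o) :=
  (contDiff_const.mul ((contDiff_fu o).pow 2)).div ((contDiff_ft s o).pow 2)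
    fun z => pow_ne_zero 2 (ft_ne s o z)

lemma contDiff_inv₁ : ContDiff ℝ ∞ (inv₁ s o) := (contDiff_fh s o).mul (contDiff_cX o)

lemma contDiff_inv₂ : ContDiff ℝ ∞ (inv₂ s o) := (contDiff_fh s o).mul (contDiff_cY o)

lemma contDiff_fq : ContDiff ℝ ∞ fun z => fq s (cN o z) :=
  (contDiff_ft s o).div (contDiff_fu o) (fu_ne o)

lemma contDiff_fm : ContDiff ℝ ∞ fun z => fm s (cN o z) :=
  contDiff_const.div ((contDiff_ft s o).pow 2) fun z => pow_ne_zero 2 (ft_ne s o z)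

lemma contDiff_nuForm (w : R6) : ContDiff ℝ ∞ fun z => nuForm o z w :=
  ((contDiff_cX o).mul contDiff_const).add ((contDiff_cY o).mul contDiff_const)

lemma contDiff_tauForm (w : R6) : ContDiff ℝ ∞ fun z => tauForm o z w :=
  ((contDiff_cX o).mul contDiff_const).add
    (contDiff_const.mul ((contDiff_cY o).mul contDiff_const))

lemma contDiff_form₀ (w : R6) : ContDiff ℝ ∞ fun z => form₀ s o z w :=
  ((contDiff_fg s o).mul contDiff_const).add
    ((contDiff_fk s o).mul ((contDiff_cX o).mul (contDiff_nuForm o w)))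

lemma contDiff_form₁ (w : R6) : ContDiff ℝ ∞ fun z => form₁ s o z w :=
  ((contDiff_fg s o).mul contDiff_const).add
    ((contDiff_fk s o).mul ((contDiff_cY o).mul (contDiff_nuForm o w)))

lemma contDiff_formβ (w : R6) : ContDiff ℝ ∞ fun z => formβ s o z w :=
  (contDiff_fc s o).mul (contDiff_tauForm o w)

lemma contDiffOn_mcForm (i : Fin 4) (w : R6) :
    ContDiffOn ℝ ∞ (fun z => quatComp i (mcForm o z w)) (domain o) := by
  have h1 : ContDiff ℝ ∞ fun z : R6 => quat (z + o) :=
    quat.contDiff.comp (contDiff_id.add contDiff_const)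
  have h2 : ContDiffOn ℝ ∞ (fun z : R6 => (quat (z + o))⁻¹) (domain o) := fun z hz =>
    ((contDiffAt_ringInverse ℝ (Units.mk0 _ hz)).comp z h1.contDiffAt).contDiffWithinAt.congr
      (fun z _ => (congrFun Ring.inverse_eq_inv' _).symm) (congrFun Ring.inverse_eq_inv' _).symm
  exact (quatComp i).contDiff.comp_contDiffOn (h2.mul contDiffOn_const)

lemma contDiffOn_form₅ (w : R6) : ContDiffOn ℝ ∞ (fun z => form₅ s o z w) (domain o) :=
  (contDiff_fq s o).contDiffOn.mul ((contDiffOn_mcForm o 0 w).add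
    ((contDiff_fm s o).mul (contDiff_tauForm o w)).contDiffOn)

lemma contDiffOn_coframe : ContDiffOn ℝ ∞ (coframe s o) (domain o) := by
  refine contDiffOn_clm_apply.2 fun w => (contDiffOn_piLp 2).2 fun i => ?_
  have h5 := contDiffOn_form₅ s o w
  have a0 := (contDiff_inv₀ s o).contDiffOn (s := domain o)
  have a1 := (contDiff_inv₁ s o).contDiffOn (s := domain o)
  have a2 := (contDiff_inv₂ s o).contDiffOn (s := domain o)
  have f0 := (contDiff_form₀ s o w).contDiffOn (s := domain o)
  have f1 := (contDiff_form₁ s o w).contDiffOn (s := domain o)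
  have fb := (contDiff_formβ s o w).contDiffOn (s := domain o)
  have p := fun i => contDiffOn_mcForm o i w
  fin_cases i
  · exact f0
  · exact f1
  · exact ((contDiffOn_const.mul (p 3)).add (contDiffOn_const.mul fb)).add
      (contDiffOn_const.mul (a0.mul h5))
  · exact ((contDiffOn_const.mul (p 1)).add (contDiffOn_const.mul (a0.mul f0))).add
      (contDiffOn_const.mul (a2.mul h5))
  · exact ((contDiffOn_const.mul (p 2)).add (contDiffOn_const.mul (a0.mul f1))).add
      (contDiffOn_const.mul (a1.mul h5))
  · exact h5

variable {s o} {y : R6}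

lemma reducedEquations_coframe (hy : y ∈ domain o) : ReducedEquations (coframe s o y)
    (dCoframe (coframe s o) y) (linβ s o y) (inv₁ s o y) (inv₂ s o y) (inv₀ s o y) := by
  obtain ⟨L₀, h0, h0'⟩ := hasFDerivAt_inv₀ (s := s) (o := o) (y := y)
  obtain ⟨L₁, h1, h1'⟩ := hasFDerivAt_inv₁ (s := s) (o := o) (y := y)
  obtain ⟨L₂, h2, h2'⟩ := hasFDerivAt_inv₂ (s := s) (o := o) (y := y)
  refine reducedEquations_of_base
    (((contDiffOn_coframe s o).contDiffAt ((isOpen_domain o).mem_nhds hy)).differentiableAt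
      (by simp)) (fun _ _ => rfl) (fun _ _ => rfl) (fun _ _ => rfl) (fun _ _ => rfl)
      (fun _ _ => rfl) (fun _ _ => rfl) (fun _ => rfl) hasExtD_form₀ hasExtD_form₁ hasExtD_formβ
      (hasExtD_form₅ hy) ((hasExtD_mcForm hy 1).congr fun v w => ?_)
      ((hasExtD_mcForm hy 2).congr fun v w => ?_) ((hasExtD_mcForm hy 3).congr fun v w => ?_)
      h1 h2 h0 h1' h2' h0'
  all_goals
    simp [quatComp_1, quatComp_2, quatComp_3, wd]
    ring

/-- The radial combination `Xω¹ + Yω²` is a nonzero multiple of `ν`; once `ν` vanishes, only the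
nonzero factor `fg` is left in each form. -/
lemma form_eq_zero_iff (v : R6) :
    form₀ s o y v = 0 ∧ form₁ s o y v = 0 ↔ v 4 = 0 ∧ v 5 = 0 := by
  constructor
  · rintro ⟨h0, h1⟩
    have hN := cN_nonneg (o := o) (y := y)
    have hs := fg_add_fk s hN
    have hN' : cN o y = cX o y ^ 2 + cY o y ^ 2 := rfl
    have hu := fu_ne o y
    have hg : fg s (cN o y) ≠ 0 :=
      (div_pos one_pos (mul_pos (fu_pos hN) (ft_pos s hN))).ne'
    have e : cX o y * form₀ s o y v + cY o y * form₁ s o y v =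
        1 / fu (cN o y) ^ 2 * nuForm o y v := by
      rw [← hs]
      simp only [form₀, form₁, nuForm]
      linear_combination - fk s (cN o y) * (cX o y * v 4 + cY o y * v 5) * hN'
    have hν : nuForm o y v = 0 := by
      rw [h0, h1, mul_zero, mul_zero, add_zero] at e
      rcases mul_eq_zero.1 e.symm with h | h
      · exact absurd h (by positivity)
      · exact h
    simp only [form₀, form₁, hν, mul_zero, add_zero] at h0 h1
    exact ⟨(mul_eq_zero.1 h0).resolve_left hg, (mul_eq_zero.1 h1).resolve_left hg⟩
  · rintro ⟨h4, h5⟩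
    simp [form₀, form₁, nuForm, h4, h5]

/-- The coframing is triangular: `ω¹, ω²` determine the last two coordinates, then `ω⁶` the real
part of `g⁻¹dg`, then the other three its imaginary part. -/
lemma coframe_bijective (hy : y ∈ domain o) : Function.Bijective (coframe s o y) := by
  have hinj : Function.Injective (coframe s o y) := by
    refine (injective_iff_map_eq_zero _).2 fun v hv => ?_
    have e : ∀ i, coframeVec s o y v i = 0 := fun i => by
      change coframe s o y v i = 0
      rw [hv]
      rfl
    have e0 : form₀ s o y v = 0 := e 0
    have e1 : form₁ s o y v = 0 := e 1
    have e2 : 2 / 3 * quatComp 3 (mcForm o y v) + 1 / 3 * formβ s o y v +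
      1 / 3 * (inv₀ s o y * form₅ s o y v) = 0 := e 2
    have e3 : 2 / 3 * quatComp 1 (mcForm o y v) + 1 / 3 * (inv₀ s o y * form₀ s o y v)
      + 1 / 3 * (inv₂ s o y * form₅ s o y v) = 0 := e 3
    have e4 : 2 / 3 * quatComp 2 (mcForm o y v) + 1 / 3 * (inv₀ s o y * form₁ s o y v)
      + -1 / 3 * (inv₁ s o y * form₅ s o y v) = 0 := e 4
    have e5 : form₅ s o y v = 0 := e 5
    obtain ⟨h4, h5⟩ := (form_eq_zero_iff v).1 ⟨e0, e1⟩
    have hτ : tauForm o y v = 0 := by simp [tauForm, h4, h5]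
    have hβ : formβ s o y v = 0 := by simp [formβ, hτ]
    have hq : fq s (cN o y) ≠ 0 := div_ne_zero (ft_ne s o y) (fu_ne o y)
    have m0 : quatComp 0 (mcForm o y v) = 0 := by
      have := e5
      rw [form₅, hτ, mul_zero, add_zero] at this
      exact (mul_eq_zero.1 this).resolve_left hq
    rw [e5, hβ] at e2
    rw [e5, e0] at e3
    rw [e5, e1] at e4
    have hm : mcForm o y v = 0 := by
      ext
      · exact m0
      · change quatComp 1 (mcForm o y v) = 0
        linarith
      · change quatComp 2 (mcForm o y v) = 0
        linarith
      · change quatComp 3 (mcForm o y v) = 0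
        linarith
    have hv' : quat v = 0 := (mul_eq_zero.1 hm).resolve_left (inv_ne_zero hy)
    ext i
    fin_cases i
    · exact congrArg (fun p : ℍ[ℝ] => p.re) hv'
    · exact congrArg (fun p : ℍ[ℝ] => p.imI) hv'
    · exact congrArg (fun p : ℍ[ℝ] => p.imJ) hv'
    · exact congrArg (fun p : ℍ[ℝ] => p.imK) hv'
    · exact h4
    · exact h5
  exact ⟨hinj, (LinearMap.injective_iff_surjective (f := (coframe s o y).toLinearMap)).1 hinj⟩

/-- The initial values of the invariants are arbitrary. -/
lemma exists_invariants (x₀ y₀ z₀ : ℝ) : ∃ s X Y : ℝ,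
    fh s (X ^ 2 + Y ^ 2) * X = x₀ ∧ fh s (X ^ 2 + Y ^ 2) * Y = y₀ ∧ fa s (X ^ 2 + Y ^ 2) = z₀ := by
  have hfh : ∀ s N : ℝ, 0 ≤ N → fh s N = (s ^ 2 - 3) / (1 + s ^ 2 * N) := fun s N hN => by
    rw [fh, ft_sq s (one_add_sq_pos s hN)]
  have hfa : ∀ s N : ℝ, 0 ≤ N → fa s N = s * (1 + 3 * N) / (1 + s ^ 2 * N) := fun s N hN => by
    rw [fa, ft_sq s (one_add_sq_pos s hN), fu_sq (one_add_pos hN)]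
  -- At the centre `a₀ = s`. This case is separate because the number `k` used below can vanish when
  -- `x₀ = y₀ = 0`.
  by_cases h : x₀ = 0 ∧ y₀ = 0
  · obtain ⟨rfl, rfl⟩ := h
    refine ⟨z₀, 0, 0, mul_zero _, mul_zero _, ?_⟩
    rw [hfa _ _ (by norm_num)]
    norm_num
  · have hp : 0 < x₀ ^ 2 + y₀ ^ 2 := by
      by_contra hp
      refine h ⟨?_, ?_⟩ <;> nlinarith [sq_nonneg x₀, sq_nonneg y₀]
    obtain ⟨p, hpd⟩ : ∃ p, p = x₀ ^ 2 + y₀ ^ 2 := ⟨_, rfl⟩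
    rw [← hpd] at hp
    -- The profiles satisfy `h = s a₀ - 3`. Hence `k = -h = 3 - s z₀`, `(X, Y) = -(x₀, y₀)/k` and `N
    -- = p/k²`; the condition on `a₀` becomes `k (z₀ - s) = s p`, that is, `z₀ s² - L s + 3 z₀ = 0`.
    obtain ⟨L, hL⟩ : ∃ L, L = p + z₀ ^ 2 + 3 := ⟨_, rfl⟩
    have hLpos : 0 < L := by nlinarith [sq_nonneg z₀]
    have hdisc : (z₀ ^ 2 - 3) ^ 2 ≤ L ^ 2 - 12 * z₀ ^ 2 := by
      rw [hL]
      nlinarith [sq_nonneg z₀]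
    obtain ⟨R, hR⟩ : ∃ R, R = √(L ^ 2 - 12 * z₀ ^ 2) := ⟨_, rfl⟩
    have hR0 : 0 ≤ R := hR ▸ Real.sqrt_nonneg _
    have hRsq : R ^ 2 = L ^ 2 - 12 * z₀ ^ 2 := by
      rw [hR, Real.sq_sqrt ((sq_nonneg _).trans hdisc)]
    have hR1 : z₀ ^ 2 - 3 ≤ R := hR ▸ Real.le_sqrt_of_sq_le hdisc
    have hLR : 0 < L + R := by linarith
    -- The root `(L - R) / (2 z₀)`, rationalized so that it makes sense at `z₀ = 0`; this root makes
    -- `k` positive.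
    obtain ⟨s, hs⟩ : ∃ s, s = 6 * z₀ / (L + R) := ⟨_, rfl⟩
    have hs' : s * (L + R) = 6 * z₀ := by rw [hs]; field_simp
    have hquad : z₀ * s ^ 2 - L * s + 3 * z₀ = 0 := by
      have : (L + R) ^ 2 * (z₀ * s ^ 2 - L * s + 3 * z₀) = 0 := by
        linear_combination (z₀ * (s * (L + R) + 6 * z₀) - L * (L + R)) * hs' + 3 * z₀ * hRsq
      exact (mul_eq_zero.1 this).resolve_left (by positivity)
    obtain ⟨k, hk⟩ : ∃ k, k = 3 - s * z₀ := ⟨_, rfl⟩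
    have hkpos : 0 < k := by
      have h1 : (L + R) * k = 3 * (L + R - 2 * z₀ ^ 2) := by
        rw [hk]
        linear_combination -z₀ * hs'
      have h2 : 0 < L + R - 2 * z₀ ^ 2 := by
        rcases le_total (z₀ ^ 2) 3 with h3 | h3 <;> linarith
      by_contra h3
      nlinarith [mul_nonneg hLR.le (neg_nonneg.2 (not_lt.1 h3))]
    have hks : k * (z₀ - s) = s * p := by
      rw [hk]
      rw [hL] at hquad
      linear_combination hquad
    have hN : (-x₀ / k) ^ 2 + (-y₀ / k) ^ 2 = p / k ^ 2 := by
      rw [hpd]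
      field_simp
    have hN0 : 0 ≤ p / k ^ 2 := by positivity
    have hpos : 0 < k ^ 2 + s ^ 2 * p := by positivity
    have e1 : (s ^ 2 - 3) / (1 + s ^ 2 * (p / k ^ 2)) = -k := by
      have : 1 + s ^ 2 * (p / k ^ 2) = (k ^ 2 + s ^ 2 * p) / k ^ 2 := by field_simp
      rw [this, div_div_eq_mul_div, div_eq_iff hpos.ne']
      rw [hk] at hks ⊢
      linear_combination (3 - s * z₀) * (-s) * hks
    refine ⟨s, -x₀ / k, -y₀ / k, ?_, ?_, ?_⟩
    · rw [hN, hfh _ _ hN0, e1]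
      field_simp
    · rw [hN, hfh _ _ hN0, e1]
      field_simp
    · rw [hN, hfa _ _ hN0]
      have e2 : 1 + s ^ 2 * (p / k ^ 2) = (k ^ 2 + s ^ 2 * p) / k ^ 2 := by field_simp
      have e3 : 1 + 3 * (p / k ^ 2) = (k ^ 2 + 3 * p) / k ^ 2 := by field_simp
      rw [e2, e3, mul_div_assoc', div_div_div_cancel_right₀ (by positivity), div_eq_iff hpos.ne']
      rw [hk] at hks ⊢
      linear_combination -(3 - s * z₀) * hks

end Coframe

/-! ### The action of `ℍˣ` and its orbits -/

section Action

open Quaternion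

/-- The inclusion of the quaternions as the first four coordinates. -/
def emb : ℍ[ℝ] →L[ℝ] R6 :=
  LinearMap.toContinuousLinearMap
    { toFun := fun p => !₂[p.re, p.imI, p.imJ, p.imK, 0, 0]
      map_add' := fun p q => by
        ext i
        fin_cases i <;> simp
      map_smul' := fun a p => by
        ext i
        fin_cases i <;> simp }

/-- The projection to the last two coordinates. -/
def tail : R6 →L[ℝ] R6 :=
  LinearMap.toContinuousLinearMap
    { toFun := fun v => !₂[0, 0, 0, 0, v 4, v 5]
      map_add' := fun p q => by
        ext i
        fin_cases i <;> simp
      map_smul' := fun a p => by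
        ext i
        fin_cases i <;> simp }

lemma emb_4 (p : ℍ[ℝ]) : emb p 4 = 0 := rfl
lemma emb_5 (p : ℍ[ℝ]) : emb p 5 = 0 := rfl
lemma tail_4 (v : R6) : tail v 4 = v 4 := rfl
lemma tail_5 (v : R6) : tail v 5 = v 5 := rfl
lemma quat_emb (p : ℍ[ℝ]) : quat (emb p) = p := rfl
lemma quat_tail (v : R6) : quat (tail v) = 0 := rfl

lemma emb_quat_add_tail (v : R6) : emb (quat v) + tail v = v := by
  ext i
  fin_cases i
  · exact add_zero (v 0)
  · exact add_zero (v 1)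
  · exact add_zero (v 2)
  · exact add_zero (v 3)
  · exact zero_add (v 4)
  · exact zero_add (v 5)

lemma emb_quat {v : R6} (h4 : v 4 = 0) (h5 : v 5 = 0) : emb (quat v) = v := by
  have : tail v = 0 := by
    ext i
    fin_cases i <;> simp [tail, h4, h5]
  simpa [this] using emb_quat_add_tail v

variable (o : R6)

/-- The action of `ℍˣ` by left multiplication on the first four coordinates, which are centred at
`-o`. -/
def act (g : ℍ[ℝ]ˣ) (z : R6) : R6 := emb (g * quat (z + o)) + tail (z + o) - o

variable {o} {s : ℝ}

lemma act_add (g : ℍ[ℝ]ˣ) (z : R6) : act o g z + o = emb (g * quat (z + o)) + tail (z + o) := by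
  simp [act]

lemma quat_act (g : ℍ[ℝ]ˣ) (z : R6) : quat (act o g z + o) = g * quat (z + o) := by
  rw [act_add, map_add, quat_emb, quat_tail, add_zero]

lemma cX_act (g : ℍ[ℝ]ˣ) (z : R6) : cX o (act o g z) = cX o z := by
  have := congrArg (fun v : R6 => v 4) (act_add (o := o) g z)
  simpa [cX, emb_4, tail_4] using this

lemma cY_act (g : ℍ[ℝ]ˣ) (z : R6) : cY o (act o g z) = cY o z := by
  have := congrArg (fun v : R6 => v 5) (act_add (o := o) g z)
  simpa [cY, emb_5, tail_5] using this

lemma act_one (z : R6) : act o 1 z = z := by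
  rw [act, Units.val_one, one_mul, emb_quat_add_tail, add_sub_cancel_right]

lemma act_mul (g h : ℍ[ℝ]ˣ) (z : R6) : act o (g * h) z = act o g (act o h z) := by
  have ht : tail (act o h z + o) = tail (z + o) := by
    ext i
    have h4 := cX_act (o := o) h z
    have h5 := cY_act (o := o) h z
    simp only [cX, cY] at h4 h5
    fin_cases i <;> simp [tail, h4, h5]
  rw [act, act, quat_act, ht, Units.val_mul, mul_assoc]

lemma act_mem (g : ℍ[ℝ]ˣ) {z : R6} (hz : z ∈ domain o) : act o g z ∈ domain o := by
  change quat (act o g z + o) ≠ 0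
  rw [quat_act]
  exact mul_ne_zero g.ne_zero hz

lemma hasFDerivAt_act (g : ℍ[ℝ]ˣ) (z : R6) :
    HasFDerivAt (act o g) (emb ∘L (ContinuousLinearMap.mul ℝ ℍ[ℝ] g) ∘L quat + tail) z := by
  have h0 : HasFDerivAt (fun z : R6 => z + o) (ContinuousLinearMap.id ℝ R6) z :=
    (hasFDerivAt_id z).add_const o
  have h1 := (emb ∘L (ContinuousLinearMap.mul ℝ ℍ[ℝ] g) ∘L quat + tail).hasFDerivAt.comp z h0
  exact h1.sub_const o

lemma fderiv_act_apply (g : ℍ[ℝ]ˣ) (z v : R6) :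
    fderiv ℝ (act o g) z v = emb (g * quat v) + tail v := by
  rw [(hasFDerivAt_act g z).fderiv]
  rfl

/-- The coframing is invariant under the action. -/
lemma coframe_act (g : ℍ[ℝ]ˣ) (z v : R6) :
    coframe s o (act o g z) (fderiv ℝ (act o g) z v) = coframe s o z v := by
  have hm : mcForm o (act o g z) (fderiv ℝ (act o g) z v) = mcForm o z v := by
    have hq : quat (fderiv ℝ (act o g) z v) = g * quat v := by
      rw [fderiv_act_apply, map_add, quat_emb, quat_tail, add_zero]
    rw [mcForm, hq, quat_act, mul_inv_rev, mul_assoc, inv_mul_cancel_left₀ g.ne_zero, mcForm]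
  have h4 : (fderiv ℝ (act o g) z v) 4 = v 4 := by
    rw [fderiv_act_apply]
    simp [emb_4, tail_4]
  have h5 : (fderiv ℝ (act o g) z v) 5 = v 5 := by
    rw [fderiv_act_apply]
    simp [emb_5, tail_5]
  change coframeVec s o _ _ = coframeVec s o _ _
  simp only [coframeVec, form₀, form₁, formβ, form₅, inv₀, inv₁, inv₂, tauForm, nuForm, cN, hm, h4,
    h5, cX_act, cY_act]

lemma isSmoothActionOn_act : IsSmoothActionOn (V := ℍ[ℝ]) (act o) (domain o) where
  mapsTo g _ hz := act_mem g hz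
  one z _ := act_one z
  mul g h z _ := act_mul g h z
  smooth := by
    have h1 : ContMDiff (𝓘(ℝ, ℍ[ℝ]).prod 𝓘(ℝ, R6)) 𝓘(ℝ, ℍ[ℝ] × R6) ∞
        (fun p : ℍ[ℝ]ˣ × R6 => ((p.1 : ℍ[ℝ]), p.2)) :=
      (Units.contMDiff_val.comp contMDiff_fst).prodMk_space contMDiff_snd
    have h2 : ContDiff ℝ ∞ (fun p : ℍ[ℝ] × R6 => emb (p.1 * quat (p.2 + o)) + tail (p.2 + o) - o) :=
      ((emb.contDiff.comp (contDiff_fst.mul (quat.contDiff.comp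
        (contDiff_snd.add contDiff_const)))).add
        (tail.contDiff.comp (contDiff_snd.add contDiff_const))).sub contDiff_const
    exact (h2.contMDiff.comp h1).contMDiffOn

/-- The differential at `1` of the orbit map. -/
def orbitMap (o y : R6) : ℍ[ℝ] →L[ℝ] R6 :=
  emb ∘L (ContinuousLinearMap.mul ℝ ℍ[ℝ]).flip (quat (y + o))

lemma orbitTangent_act (y : R6) :
    orbitTangent (V := ℍ[ℝ]) (act o) y = LinearMap.range (orbitMap o y).toLinearMap := by
  have h1 : HasFDerivAt (fun p : ℍ[ℝ] => emb (p * quat (y + o)) + tail (y + o) - o) (orbitMap o y)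
      ((1 : ℍ[ℝ]ˣ) : ℍ[ℝ]) :=
    ((orbitMap o y).hasFDerivAt.add_const _).sub_const _
  have h2 := h1.hasMFDerivAt.comp (1 : ℍ[ℝ]ˣ) (hasMFDerivAt_unitsVal (1 : ℍ[ℝ]ˣ))
  have h3 : mfderiv 𝓘(ℝ, ℍ[ℝ]) 𝓘(ℝ, R6) (fun g : ℍ[ℝ]ˣ => act o g y) 1 = orbitMap o y := h2.mfderiv
  unfold orbitTangent
  rw [h3]
  rfl

lemma mem_orbitTangent_act {y : R6} (hy : y ∈ domain o) (v : R6) :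
    v ∈ orbitTangent (V := ℍ[ℝ]) (act o) y ↔ v 4 = 0 ∧ v 5 = 0 := by
  rw [orbitTangent_act, LinearMap.mem_range]
  constructor
  · rintro ⟨p, rfl⟩
    exact ⟨rfl, rfl⟩
  · rintro ⟨h4, h5⟩
    refine ⟨quat v * (quat (y + o))⁻¹, ?_⟩
    change emb (quat v * (quat (y + o))⁻¹ * quat (y + o)) = v
    rw [inv_mul_cancel_right₀ hy, emb_quat h4 h5]

lemma finrank_orbitTangent_act {y : R6} (hy : y ∈ domain o) :
    Module.finrank ℝ (orbitTangent (V := ℍ[ℝ]) (act o) y) = 4 := by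
  rw [orbitTangent_act, LinearMap.finrank_range_of_inj, Quaternion.finrank_eq_four]
  intro p q h
  have h' : p * quat (y + o) = q * quat (y + o) := by
    have := congrArg quat h
    exact this
  exact mul_right_cancel₀ hy h'

lemma isO2Coframe_coframe {y : R6} (hy : y ∈ domain o) :
    IsO2Coframe (omegaOf (coframe s o)) (upsilonOf (coframe s o))
      (orbitTangent (V := ℍ[ℝ]) (act o)) y (coframe s o y) :=
  ⟨isSU3Coframe_of _ (coframe_bijective hy), fun v =>
    (mem_orbitTangent_act hy v).trans (form_eq_zero_iff v).symm⟩

lemma emb_one_sub_mem : emb 1 - o ∈ domain o := by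
  change quat (emb 1 - o + o) ≠ 0
  rw [sub_add_cancel, quat_emb]
  exact one_ne_zero

lemma act_eq_iff {z : R6} (hz : z ∈ domain o) (g : ℍ[ℝ]ˣ) : act o g z = z ↔ g = 1 := by
  constructor
  · intro h
    have h1 := quat_act (o := o) g z
    rw [h] at h1
    refine Units.ext (mul_right_cancel₀ hz ?_)
    rw [← h1, Units.val_one, one_mul]
  · rintro rfl
    exact act_one z

theorem isCohomTwoSymmetry_act : IsCohomTwoSymmetry (V := ℍ[ℝ]) (domain o) (omegaOf (coframe s o))
    (upsilonOf (coframe s o)) (act o) where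
  action := isSmoothActionOn_act
  preserves_omega g y _ v := by
    change stdOmega (coframe s o _ _) (coframe s o _ _) =
      stdOmega (coframe s o y (v 0)) (coframe s o y (v 1))
    rw [coframe_act, coframe_act]
  preserves_upsilon g y _ v := by
    change stdUpsilon (fun i => coframe s o _ _) = stdUpsilon (fun i => coframe s o _ _)
    simp only [coframe_act]
  faithful g h := (act_eq_iff emb_one_sub_mem g).1 (h _ emb_one_sub_mem)
  closed g h hm hlim := by
    have ht := fun (z : R6) (hz : z ∈ domain o) => hlim.tendsto_at hz
    have hcont : Continuous fun z : R6 => quat (z + o) :=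
      quat.continuous.comp (continuous_id.add continuous_const)
    -- At the point whose quaternion is `1` the action reads off the group element, so pointwise
    -- convergence there makes `g n` converge in `ℍ`. The limit is nonzero because `h` preserves the
    -- domain.
    have h1 : Tendsto (fun n => ((g n : ℍ[ℝ]ˣ) : ℍ[ℝ])) atTop
        (𝓝 (quat (h (emb 1 - o) + o))) := by
      have := (hcont.tendsto _).comp (ht _ emb_one_sub_mem)
      refine this.congr fun n => ?_
      change quat (act o (g n) (emb 1 - o) + o) = _
      rw [quat_act, sub_add_cancel, quat_emb, mul_one]
    refine ⟨Units.mk0 _ (hm emb_one_sub_mem), fun z hz => ?_⟩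
    refine tendsto_nhds_unique ?_ (ht z hz)
    exact ((emb.continuous.tendsto _).comp (h1.mul_const _)).add_const _ |>.sub_const _
  principal y hy z hz := ⟨1, fun g => by simp [act_eq_iff hy, act_eq_iff hz]⟩
  cohomogeneity_two y hy := finrank_orbitTangent_act hy
  coisotropic y hy v hv := by
    have hO := (isO2Coframe_coframe (s := s) hy).2
    have h0 : ∀ i, coframe s o y (v i) 0 = 0 := fun i => ((hO _).1 (hv i)).1
    have h1 : ∀ i, coframe s o y (v i) 1 = 0 := fun i => ((hO _).1 (hv i)).2
    -- On an orbit `ω¹ = ω² = 0`, so `Ω` restricts to the decomposable form `ω³∧ω⁶`, whose square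
    -- vanishes.
    have e : ∀ i j, omegaOf (coframe s o) y ![v i, v j] = coframe s o y (v i) 2 *
        coframe s o y (v j) 5 - coframe s o y (v i) 5 * coframe s o y (v j) 2 := by
      intro i j
      change stdOmega (coframe s o y (v i)) (coframe s o y (v j)) = _
      simp [stdOmega, h0, h1]
    simp only [omegaSq, e]
    ring

lemma isConnected_domain : IsConnected (domain o) := by
  have h1 : IsConnected ({0}ᶜ : Set ℍ[ℝ]) := by
    apply isConnected_compl_singleton_of_one_lt_rank
    rw [Quaternion.rank_eq_four]
    norm_num
  have h2 := (h1.prod (isConnected_univ (α := R6))).image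
    (fun p : ℍ[ℝ] × R6 => emb p.1 + tail p.2 - o)
    (((emb.continuous.comp continuous_fst).add (tail.continuous.comp continuous_snd)).sub
      continuous_const).continuousOn
  convert h2
  ext z
  constructor
  · intro hz
    exact ⟨(quat (z + o), z + o), ⟨hz, mem_univ _⟩, by
      simp only [emb_quat_add_tail, add_sub_cancel_right]⟩
  · rintro ⟨p, ⟨hp, -⟩, rfl⟩
    change quat (emb p.1 + tail p.2 - o + o) ≠ 0
    rw [sub_add_cancel, map_add, quat_emb, quat_tail, add_zero]
    exact hp

lemma connectedSpace_quaternion_units : ConnectedSpace ℍ[ℝ]ˣ := by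
  have h1 : IsConnected ({0}ᶜ : Set ℍ[ℝ]) := by
    apply isConnected_compl_singleton_of_one_lt_rank
    rw [Quaternion.rank_eq_four]
    norm_num
  have : ConnectedSpace {p : ℍ[ℝ] // p ≠ 0} := isConnected_iff_connectedSpace.1 h1
  exact (unitsHomeomorphNeZero (G₀ := ℍ[ℝ])).symm.surjective.connectedSpace
    (unitsHomeomorphNeZero (G₀ := ℍ[ℝ])).symm.continuous

end Action

end NK

end

/-! ### Existence with prescribed invariants -/

open NK in
theorem theorem6p1 (x : R6) (x₀ y₀ z₀ : ℝ) :
    ∃ U : Set R6, IsOpen U ∧ IsConnected U ∧ x ∈ U ∧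
    ∃ (Ω : TwoForm) (Υ : ThreeFormC), IsNearlyKahlerOn U Ω Υ ∧
    ∃ (V : Type) (_ : NormedAddCommGroup V) (_ : NormedSpace ℝ V) (_ : FiniteDimensional ℝ V)
      (G : Type) (_ : Group G) (_ : TopologicalSpace G) (_ : ChartedSpace V G)
      (_ : LieGroup 𝓘(ℝ, V) ∞ G) (_ : T2Space G) (_ : ConnectedSpace G)
      (act : G → R6 → R6),
      HasLieAlgebraSU2U1 V G ∧
      IsCohomTwoSymmetry (V := V) U Ω Υ act ∧
      IsTypeIIIWithUZero U Ω Υ (orbitTangent (V := V) act) ∧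
      ∃ (f : R6 →L[ℝ] R6) (T : Torsion) (N : TypeIIIInvariants),
        IsO2Coframe Ω Υ (orbitTangent (V := V) act) x f ∧
        T.IsAt Ω Υ (orbitTangent (V := V) act) x f ∧ N.Of T ∧
        N.a₁ = x₀ ∧ N.a₂ = y₀ ∧ N.a₀ = z₀ := by
  obtain ⟨s, X, Y, h1, h2, h0⟩ := exists_invariants x₀ y₀ z₀
  -- The translation by `o` places `x` at the quaternion `1` over the orbit-space point `(X, Y)`.
  let o : R6 := !₂[1, 0, 0, 0, X, Y] - x
  have hxo : x + o = !₂[1, 0, 0, 0, X, Y] := add_sub_cancel x _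
  have hX : cX o x = X := by
    exact congrArg (fun v : R6 => v 4) hxo
  have hY : cY o x = Y := by
    exact congrArg (fun v : R6 => v 5) hxo
  have hx : x ∈ domain o := by
    change quat (x + o) ≠ 0
    rw [hxo]
    exact fun h => one_ne_zero (congrArg (fun p : Quaternion ℝ => p.re) h)
  have hU := isOpen_domain o
  have hσ := contDiffOn_coframe s o
  have hO := fun y (hy : y ∈ domain o) => isO2Coframe_coframe (s := s) hy
  have hR := fun y (hy : y ∈ domain o) => reducedEquations_coframe (s := s) hy
  refine ⟨domain o, hU, isConnected_domain, hx, omegaOf (coframe s o), upsilonOf (coframe s o),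
    isNearlyKahlerOn_of_reducedEquations hU hσ (fun y hy => coframe_bijective hy)
      (fun y hy => ⟨_, _, _, _, hR y hy⟩),
    Quaternion ℝ, inferInstance, inferInstance, inferInstance, (Quaternion ℝ)ˣ, inferInstance,
    inferInstance, inferInstance, inferInstance, inferInstance, connectedSpace_quaternion_units,
    NK.act o, hasLieAlgebraSU2U1_quaternion_units, isCohomTwoSymmetry_act,
    isTypeIIIWithUZero_of_reducedEquations hU hσ hO (fun y hy => ⟨_, _, _, _, hR y hy⟩),
    coframe s o x, _, _, hO x hx, isAt_of_reducedEquations hU hσ hO hx (hR x hx),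
    reducedInvariants_of _ _ _, ?_, ?_, ?_⟩
  · change 24 * (inv₁ s o x / 24) = x₀
    rw [inv₁, cN, hX, hY, h1]
    ring
  · change 24 * (inv₂ s o x / 24) = y₀
    rw [inv₂, cN, hX, hY, h2]
    ring
  · change 3 * (inv₀ s o x / 3) = z₀
    rw [inv₀, cN, hX, hY, h0]
    ring
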